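/- **Setting.** Fix a set of constants $c$ and a set of basic types $b$; each constant $c$ has a basic type $b_c$, and each $b$ denotes a set $\mathbb B(b)$ of constants with $c\in\mathbb B(b_c)$. *Types* $t$ are the regular and contractive terms coinductively generated by $b$, polymorphic variables $\alpha$, monomorphic variables $\boldsymbol\alpha$, $t\to t$, $t\times t$, $t\vee t$, $\neg t$ and $\mathbb 0$. We write $\mathbb 1=\neg\mathbb 0$, $t\wedge s=\neg(\neg t\vee\neg s)$, $t\setminus s=t\wedge\neg s$. Subtyping $\le$ is inclusion of the set-theoretic interpretations of types in the domain $d::=c^L\mid(d,d)^L\mid\{(d,\partial),\dots,(d,\partial)\}^L$, $\partial::=d\mid\Omega$, with $L$ a finite set of type variables that interprets them ($d\in\alpha$ iff $\alpha$ is in the label of $d$); a finite relation belongs to $t\to s$ iff it maps each element of $t$ that occurs in it as an input only to elements of $s$. We write $t\simeq s$ for $t\le s\le t$. *Atoms* are $a::=c\mid x\mid\lambda x.\kappa\mid(\mathsf x,\mathsf x)\mid\mathsf x\mathsf x\mid\pi_i\mathsf x\mid(\mathsf x{\in}\tau)\,?\,\mathsf x:\mathsf x$ and *canonical forms* are $\kappa::=\mathsf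 x\mid\mathtt{bind}\ \mathsf x=a\ \mathtt{in}\ \kappa$, with lambda variables $x$, binding variables $\mathsf x$ and test types $\tau$, which have no type variable and no arrow other than $\mathbb 0\to\mathbb 1$. The letter $\eta$ stands for an atom or a canonical form. An environment $\Gamma$ is a finite map from variables to types. *Intermediate annotations* of $\eta$ are $$\mathcal A,\mathcal B::=\mathsf{infer}\mid\mathsf{untyp}\mid\mathsf{typ}\mid\bigwedge(S,S')\mid\mathsf{then}\mid\mathsf{else}\mid\lambda(t,\mathcal B)\mid\mathsf{tryskip}(\mathcal B)\mid\mathsf{trykeep}(\mathcal A,\mathcal B,\mathcal B)\mid\mathsf{prop}(\mathcal A,\mathbb G,\mathcal S,\mathcal S')\mid\mathsf{skip}(\mathcal B)\mid\mathsf{keep}(\mathcal A,\mathcal S,\mathcal S')$$ with finite sets $S,S'$ of annotations, $\mathbb G$ of environments, and $\mathcal S,\mathcal S'$ of pairs of a type and an annotation. *Results* are $$R::=\mathsf{Ok}(\mathcal A)\mid\mathsf{Fail}\mid\mathsf{Split}(\Gamma,\mathcal A_1,\mathcal A_2)\mid\mathsf{Subst}(\Psi,\mathcal A_1,\mathcal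 A_2)\mid\mathsf{Var}(\mathsf x,\mathcal A_1,\mathcal A_2),$$ with $\Psi$ a finite set of substitutions from monomorphic variables to monomorphic types; $R[f]$ denotes $R$ with $f$ applied to each of its annotations. *Side judgments.* $\mathrm{tally}(t,s)$ is a finite principal set of substitutions $\sigma$ of polymorphic variables with $t\sigma\le s\sigma$; $\mathrm{tallyinfer}(t,s)$ is obtained from a finite principal set of solutions of $t\le s$ in all type variables (the polymorphic variables of $t$ and $s$ being renamed apart) by restricting each solution to the monomorphic variables and replacing the polymorphic variables of its images by fresh monomorphic ones. A *type $s$ of $a$ in $\Gamma$ under $\mathcal A$* is one obtained by converting the fully processed annotation $\mathcal A$ into an explicit annotation of $a$ (by means of tally) and typing $a$ with it in the algorithmic type system. $\mathrm{prop}_\Gamma(a,t)$ is a finite set of environments, each giving assumptions meant to ensure that $a$ has type $t$: $\{\emptyset\}$ for a constant or lambda variable whose type is a subtype of $t$, and $\emptyset$ for the other ones and for abstractions; $\{\{\mathsf x:t\times\mathbb 1\}\}$ for $\pi_1\mathsf x$, and symmetrically for $\pi_2$; $\{\{\mathsf x:\tau\}\wedge\{\mathsf x_1:t\},\{\mathsf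 x:\neg\tau\}\wedge\{\mathsf x_2:t\}\}$ for $(\mathsf x{\in}\tau)?\mathsf x_1:\mathsf x_2$; all $\{\mathsf x_1:t_i\}\wedge\{\mathsf x_2:s_i\}$ for $(\mathsf x_1,\mathsf x_2)$, where the $t_i\times s_i$ are the products in a disjunctive normal form of $t$; and for $\mathsf x_1\mathsf x_2$ all $\{\mathsf x_1:t_i\sigma\sigma'\}\wedge\{\mathsf x_2:\alpha\sigma\sigma'\}$, where $t_i$ is a summand of a disjunctive normal form of $\Gamma(\mathsf x_1)$, $\sigma\in\mathrm{tally}(t_i,\alpha\to t)$, $\alpha$ is fresh, and $\sigma'$ maps the remaining polymorphic variables to $\mathbb 1$, to $\mathbb 0$, or to fresh monomorphic variables, according to whether they are in $\alpha\sigma$ not contravariant, only contravariant, or of both variances. **Rules.** There are two judgments, $\Gamma\vdash\langle\eta\mid\mathcal A\rangle\Rightarrow R$ (plain) and $\Gamma\vdash^*\langle\eta\mid\mathcal A\rangle\Rightarrow R$ (iterated), with input $(\Gamma,\eta,\mathcal A)$ and output $R$. Within each group the rules are listed by decreasing priority, a rule being used only if no earlier one is; "$\{X\}\cup S$" means $X\notin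 S$, with $X$ chosen arbitrarily. We write $\beta$ for $\mathtt{bind}\ \mathsf x=a\ \mathtt{in}\ \kappa$, and "$\eta\mid\mathcal A$: $R$" for a rule with result $R$. - Any $\eta$. $\mathsf{typ}$: $\mathsf{Ok}(\mathsf{typ})$. $\mathsf{untyp}$: $\mathsf{Fail}$. $\bigwedge(\emptyset,\emptyset)$: $\mathsf{Fail}$. $\bigwedge(\emptyset,S')$: $\mathsf{Ok}(\bigwedge(\emptyset,S'))$. $\bigwedge(\{\mathcal A\}\cup S,S')$: evaluate $\Gamma\vdash^*\langle\eta\mid\mathcal A\rangle\Rightarrow R$; if $R=\mathsf{Ok}(\mathcal A')$, the result is the plain one of $\bigwedge(S,\{\mathcal A'\}\cup S')$; if $R=\mathsf{Fail}$, that of $\bigwedge(S,S')$; otherwise it is $R[X\mapsto\bigwedge(\{X\}\cup S,S')]$. - $c\mid\mathsf{infer}$: $\mathsf{Ok}(\mathsf{typ})$. $x\mid\mathsf{infer}$: $\mathsf{Ok}(\mathsf{typ})$ if $x\in\mathrm{dom}\,\Gamma$, otherwise $\mathsf{Fail}$. - $\eta\mid\mathsf{infer}$ for $\eta$ one of $\mathsf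 x_1$, $(\mathsf x_1,\mathsf x_2)$, $\pi_i\mathsf x_1$, $\mathsf x_1\mathsf x_2$: $\mathsf{Var}(\mathsf x_j,\mathsf{infer},\mathsf{untyp})$ for the first $\mathsf x_j\notin\mathrm{dom}\,\Gamma$, if any. Otherwise $\mathsf{Ok}(\mathsf{typ})$ for $\mathsf x_1$ and $(\mathsf x_1,\mathsf x_2)$, and $\mathsf{Subst}(\Psi,\mathsf{typ},\mathsf{untyp})$ with $\Psi=\mathrm{tallyinfer}(\Gamma(\mathsf x_1),\alpha\times\alpha')$ for $\pi_i\mathsf x_1$ and $\Psi=\mathrm{tallyinfer}(\Gamma(\mathsf x_1),\Gamma(\mathsf x_2)\to\alpha)$ for $\mathsf x_1\mathsf x_2$, with $\alpha,\alpha'$ fresh. - $(\mathsf x{\in}\tau)?\mathsf x_1:\mathsf x_2\mid\mathsf{infer}$: $\mathsf{Var}(\mathsf x,\mathsf{infer},\mathsf{untyp})$ if $\mathsf x\notin\mathrm{dom}\,\Gamma$; $\mathsf{Split}(\{\mathsf x:\tau\},\mathsf{infer},\mathsf{infer})$ if $\Gamma(\mathsf x)\not\le\tau$ and $\Gamma(\mathsf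 x)\not\le\neg\tau$; $\mathsf{Ok}(\mathsf{typ})$ if $\Gamma(\mathsf x)\simeq\mathbb 0$; and with $\Psi=\mathrm{tallyinfer}(\Gamma(\mathsf x),\mathbb 0)$, $\mathsf{Subst}(\Psi,\mathsf{typ},\mathsf{then})$ if $\Gamma(\mathsf x)\le\tau$ and $\mathsf{Subst}(\Psi,\mathsf{typ},\mathsf{else})$ if $\Gamma(\mathsf x)\le\neg\tau$. With annotation $\mathsf{then}$ (put $i=1$) or $\mathsf{else}$ ($i=2$): $\mathsf{Var}(\mathsf x_i,\mathsf{typ},\mathsf{untyp})$ if $\mathsf x_i\notin\mathrm{dom}\,\Gamma$, otherwise $\mathsf{Ok}(\mathsf{typ})$. - $\lambda x.\kappa\mid\mathsf{infer}$: the plain result of $\lambda(\boldsymbol\alpha,\mathsf{infer})$, $\boldsymbol\alpha$ fresh. $\lambda(\mathbb 0,\mathcal B)$: $\mathsf{Fail}$. $\lambda(t,\mathcal B)$: $R[X\mapsto\lambda(t,X)]$ where $\Gamma,x{:}t\vdash^*\langle\kappa\mid\mathcal B\rangle\Rightarrow R$. - $\beta\mid\mathsf{infer}$: the plain result of $\mathsf{tryskip}(\mathsf{infer})$.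 $\beta\mid\mathsf{tryskip}(\mathcal B)$: evaluate $\Gamma\vdash^*\langle\kappa\mid\mathcal B\rangle\Rightarrow R$; if $R=\mathsf{Var}(\mathsf x,\mathcal B_1,\mathcal B_2)$, the plain result of $\mathsf{trykeep}(\mathsf{infer},\mathcal B_1,\mathcal B_2)$; if $R=\mathsf{Ok}(\mathcal B')$, $\mathsf{Ok}(\mathsf{skip}(\mathcal B'))$; otherwise $R[X\mapsto\mathsf{tryskip}(X)]$. $\beta\mid\mathsf{skip}(\mathcal B)$: evaluate the same judgment; if $R=\mathsf{Var}(\mathsf x,\mathcal B_1,\mathcal B_2)$, the plain result of $\mathsf{skip}(\mathcal B_2)$; otherwise $R[X\mapsto\mathsf{skip}(X)]$. - $\beta\mid\mathsf{trykeep}(\mathcal A,\mathcal B_1,\mathcal B_2)$: evaluate $\Gamma\vdash^*\langle a\mid\mathcal A\rangle\Rightarrow R$; if $R=\mathsf{Ok}(\mathcal A')$, the plain result of $\mathsf{keep}(\mathcal A',\{(\mathbb 1,\mathcal B_1)\},\emptyset)$; if $R=\mathsf{Fail}$, that of $\mathsf{skip}(\mathcal B_2)$; otherwise $R[X\mapsto\mathsf{trykeep}(X,\mathcal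 B_1,\mathcal B_2)]$. - $\beta\mid\mathsf{keep}(\mathcal A,\emptyset,\mathcal S')$: $\mathsf{Ok}$ of this annotation. $\beta\mid\mathsf{keep}(\mathcal A,\{(t,\mathcal B)\}\cup\mathcal S,\mathcal S')$: let $s$ be a type of $a$ in $\Gamma$ under $\mathcal A$, and evaluate $\Gamma,\mathsf x{:}s\wedge t\vdash^*\langle\kappa\mid\mathcal B\rangle\Rightarrow R$; if $R=\mathsf{Ok}(\mathcal B')$, the plain result of $\mathsf{keep}(\mathcal A,\mathcal S,\{(t,\mathcal B')\}\cup\mathcal S')$; if $R=\mathsf{Split}(\Gamma',\mathcal B_1,\mathcal B_2)$ with $\Gamma'(\mathsf x)=u$, the result $\mathsf{Split}(\Gamma'\setminus\mathsf x,\mathsf{prop}(\mathcal A,\mathbb G,\{(t\wedge u,\mathcal B_1),(t\setminus u,\mathcal B_2)\}\cup\mathcal S,\mathcal S'),\mathsf{keep}(\mathcal A,\{(t,\mathcal B_2)\}\cup\mathcal S,\mathcal S'))$ with $\mathbb G=\mathrm{prop}_\Gamma(a,\neg(t\wedge u))\cup\mathrm{prop}_\Gamma(a,\neg(t\setminus u))$;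 otherwise $R[X\mapsto\mathsf{keep}(\mathcal A,\{(t,X)\}\cup\mathcal S,\mathcal S')]$. - $\beta\mid\mathsf{prop}(\mathcal A,\mathbb G,\mathcal S,\mathcal S')$: if some $\Gamma'\in\mathbb G$ satisfies $\mathrm{dom}\,\Gamma'\subseteq\mathrm{dom}\,\Gamma$ and, for each $\mathsf y\in\mathrm{dom}\,\Gamma'$, $\Gamma(\mathsf y)\wedge\Gamma'(\mathsf y)\not\simeq\mathbb 0$ or $\Gamma(\mathsf y)\simeq\mathbb 0$, the result $\mathsf{Split}(\{(\mathsf y{:}t)\in\Gamma'\mid\Gamma(\mathsf y)\not\le t\},\mathsf{keep}(\mathcal A,\mathcal S,\mathcal S'),\mathsf{prop}(\mathcal A,\mathbb G\setminus\{\Gamma'\},\mathcal S,\mathcal S'))$; otherwise the plain result of $\mathsf{keep}(\mathcal A,\mathcal S,\mathcal S')$. - Iteration. For $\Gamma\vdash^*\langle\eta\mid\mathcal A\rangle$, evaluate $\Gamma\vdash\langle\eta\mid\mathcal A\rangle\Rightarrow R$; if $R=\mathsf{Split}(\emptyset,\mathcal A_1,\mathcal A_2)$, the result is that of $\Gamma\vdash^*\langle\eta\mid\mathcal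 A_1\rangle$; if $R=\mathsf{Subst}(\Psi,\mathcal A_1,\mathcal A_2)$ and no $\psi\in\Psi$ has a type variable of $\Gamma$ in its domain, it is that of $\Gamma\vdash^*\langle\eta\mid\bigwedge(\{\mathcal A_1\psi\mid\psi\in\Psi\}\cup\{\mathcal A_2\},\emptyset)\rangle$; otherwise it is $R$. The *algorithm* evaluates a judgment by goal-directed use of the rules: it evaluates the premises from left to right, each one recursively, with a stack of judgments under evaluation, and returns the result of the conclusion when all premises of a rule have been evaluated. It *fails* when, at some point, no rule applies to the current judgment given the results of its premises evaluated so far. Side judgments count as single operations; the choices that the rules leave open (fresh variables, elements of sets, principal sets of solutions) are arbitrary. **Theorem (Termination).** For every mode (plain or iterated), environment $\Gamma$, atom or canonical form $\eta$ and intermediate annotation $\mathcal A$: (1) no run of the algorithm on the input $(\Gamma,\eta,\mathcal A)$ is infinite, whatever choices are made; (2) every run that cannot be continued has either failed or returned a result $R$; (3) the results $R$ that a run can return are exactly those for which the judgment with this input and result $R$ is derivable by the rules. -/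

import Mathlib

namespace Recon

/-- The parameters of the language: constants, basic types, the basic type of a constant, and the
set of constants that each basic type denotes. -/
structure Sig where
  Const : Type
  Base : Type
  basic : Const → Base
  consts : Base → Set Const
  basic_mem : ∀ c, c ∈ consts (basic c)

/-- Type variables, either polymorphic or monomorphic. -/
inductive TVar where
  | poly (n : ℕ)
  | mono (n : ℕ)

/-! ### Types: regular and contractive infinite terms -/

inductive Label (S : Sig) where
  | base (b : S.Base)
  | var (α : TVar)
  | arrow
  | prod
  | or
  | neg
  | empty

def Label.arity {S : Sig} : Label S → ℕ
  | .base _ => 0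
  | .var _ => 0
  | .arrow => 2
  | .prod => 2
  | .or => 2
  | .neg => 1
  | .empty => 0

def treeF (S : Sig) : PFunctor.{0, 0} := ⟨Label S, fun l => Fin l.arity⟩

/-- Terms coinductively produced by the grammar of types. -/
abbrev Tree (S : Sig) : Type := (treeF S).M

namespace Tree

variable {S : Sig}

def label (t : Tree S) : Label S := t.dest.1

def IsChild (u t : Tree S) : Prop := ∃ i, t.dest.2 i = u

inductive Subterm : Tree S → Tree S → Prop
  | refl (t : Tree S) : Subterm t t
  | step {u v t : Tree S} : IsChild v t → Subterm u v → Subterm u t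

def Regular (t : Tree S) : Prop := {u | Subterm u t}.Finite

/-- Every infinite branch contains infinitely many arrows or products. -/
def Contractive (t : Tree S) : Prop :=
  ∀ br : ℕ → Tree S, br 0 = t → (∀ n, IsChild (br (n + 1)) (br n)) →
    ∀ N, ∃ n ≥ N, (br n).label = .arrow ∨ (br n).label = .prod

def WF (t : Tree S) : Prop := Regular t ∧ Contractive t

theorem WF.child {u t : Tree S} (h : WF t) (hu : IsChild u t) : WF u := by
  refine ⟨h.1.subset fun v hv => Subterm.step hu hv, fun br h0 hbr N => ?_⟩
  obtain ⟨n, hn, hl⟩ := h.2 (fun n => Nat.casesOn n t br) rfl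
    (fun n => by cases n with
      | zero => simpa [h0] using hu
      | succ n => exact hbr n) (N + 1)
  cases n with
  | zero => omega
  | succ n => exact ⟨n, by omega, hl⟩

theorem WF.of_children {t : Tree S} (h : ∀ u, IsChild u t → WF u) : WF t := by
  constructor
  · have hs : {u | Subterm u t} ⊆ {t} ∪ ⋃ i, {u | Subterm u (t.dest.2 i)} := by
      intro u hu
      cases hu with
      | refl => simp
      | step hc hu =>
        obtain ⟨i, rfl⟩ := hc
        exact Or.inr (Set.mem_iUnion.2 ⟨i, hu⟩)
    have : Finite ((treeF S).B t.dest.1) := inferInstanceAs (Finite (Fin _))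
    exact ((Set.finite_singleton t).union
      (Set.finite_iUnion fun i => (h _ ⟨i, rfl⟩).1)).subset hs
  · intro br h0 hbr N
    obtain ⟨n, hn, hl⟩ := (h (br 1) (h0 ▸ hbr 0)).2 (fun n => br (n + 1)) rfl
      (fun n => hbr (n + 1)) N
    exact ⟨n + 1, by omega, hl⟩

theorem Subterm.trans {u v t : Tree S} (h : Subterm u v) (h' : Subterm v t) : Subterm u t := by
  induction h' with
  | refl => exact h
  | step hc _ ih => exact Subterm.step hc ih

/-- One step of the application of a substitution: `inl u` is a subterm of the original term,
`inr u` is a subterm of a term that has been substituted for a variable. -/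
def substStep (σ : TVar → Tree S) : Tree S ⊕ Tree S → (treeF S) (Tree S ⊕ Tree S)
  | .inr u => (treeF S).map Sum.inr u.dest
  | .inl u =>
    match u.label with
    | .var α => (treeF S).map Sum.inr (σ α).dest
    | _ => (treeF S).map Sum.inl u.dest

def substFrom (σ : TVar → Tree S) (s : Tree S ⊕ Tree S) : Tree S :=
  PFunctor.M.corec (substStep σ) s

theorem dest_substFrom (σ : TVar → Tree S) (s : Tree S ⊕ Tree S) :
    (substFrom σ s).dest = (treeF S).map (substFrom σ) (substStep σ s) :=
  PFunctor.M.dest_corec _ _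

/-- Application of a substitution to a term. -/
def subst (σ : TVar → Tree S) (t : Tree S) : Tree S := substFrom σ (Sum.inl t)

theorem isChild_substFrom_inr {σ : TVar → Tree S} {u v : Tree S}
    (h : IsChild v (substFrom σ (.inr u))) :
    ∃ w, IsChild w u ∧ v = substFrom σ (.inr w) := by
  unfold IsChild at h
  rw [dest_substFrom] at h
  obtain ⟨i, rfl⟩ := h
  exact ⟨_, ⟨i, rfl⟩, rfl⟩

theorem isChild_substFrom_inl {σ : TVar → Tree S} {u v : Tree S}
    (h : IsChild v (substFrom σ (.inl u))) :
    (∃ w, IsChild w u ∧ v = substFrom σ (.inl w) ∧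
      (substFrom σ (.inl u)).label = u.label) ∨
    ∃ α w, u.label = .var α ∧ IsChild w (σ α) ∧
      v = substFrom σ (.inr w) := by
  unfold IsChild label at *
  rw [dest_substFrom] at h ⊢
  by_cases hv : ∃ α, u.dest.1 = .var α
  · obtain ⟨α, hα⟩ := hv
    have hs : substStep σ (.inl u) = (treeF S).map Sum.inr (σ α).dest := by
      simp only [substStep, label, hα]
    rw [hs] at h
    obtain ⟨i, rfl⟩ := h
    exact Or.inr ⟨α, _, hα, ⟨i, rfl⟩, rfl⟩
  · have hs : substStep σ (.inl u) = (treeF S).map Sum.inl u.dest := by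
      cases hl : u.dest.1 with
      | var α => exact absurd ⟨α, hl⟩ hv
      | _ => simp only [substStep, label, hl]
    rw [hs] at h ⊢
    obtain ⟨i, rfl⟩ := h
    exact Or.inl ⟨_, ⟨i, rfl⟩, rfl, rfl⟩

theorem label_substFrom_inr (σ : TVar → Tree S) (u : Tree S) :
    (substFrom σ (.inr u)).label = u.label := by
  unfold label
  rw [dest_substFrom]
  rfl

theorem wf_substFrom_inr {σ : TVar → Tree S} {u : Tree S} (h : WF u) :
    WF (substFrom σ (.inr u)) := by
  constructor
  · have key : ∀ v w, Subterm v w → ∀ u, w = substFrom σ (.inr u) →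
        ∃ z, Subterm z u ∧ v = substFrom σ (.inr z) := by
      intro v w hvw
      induction hvw with
      | refl => exact fun u hu => ⟨u, .refl _, hu⟩
      | step hc _ ih =>
        rintro u rfl
        obtain ⟨w, hw, rfl⟩ := isChild_substFrom_inr hc
        obtain ⟨z, hz, rfl⟩ := ih w rfl
        exact ⟨z, .step hw hz, rfl⟩
    refine (h.1.image fun z => substFrom σ (.inr z)).subset ?_
    intro v hv
    obtain ⟨z, hz, rfl⟩ := key v _ hv u rfl
    exact ⟨z, hz, rfl⟩
  · intro br h0 hbr N
    let C : Tree S → Tree S := fun z => substFrom σ (.inr z)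
    let next : (n : ℕ) → {z // br n = C z} → {z // br (n + 1) = C z} := fun n z =>
      ⟨(isChild_substFrom_inr ((congrArg (IsChild _) z.2).mp (hbr n))).choose,
        (isChild_substFrom_inr ((congrArg (IsChild _) z.2).mp (hbr n))).choose_spec.2⟩
    let st : (n : ℕ) → {z // br n = C z} := fun n => Nat.rec ⟨u, h0⟩ next n
    obtain ⟨n, hn, hl⟩ := h.2 (fun n => (st n).1) rfl
      (fun n => (isChild_substFrom_inr ((congrArg (IsChild _) (st n).2).mp (hbr n))).choose_spec.1) N
    refine ⟨n, hn, ?_⟩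
    rw [(st n).2]
    simpa only [C, label_substFrom_inr] using hl

theorem WF.subst {σ : TVar → Tree S} (hσ : ∀ α, WF (σ α)) {t : Tree S} (h : WF t) :
    WF (t.subst σ) := by
  constructor
  · have key : ∀ v w, Subterm v w → ∀ u, w = substFrom σ (.inl u) →
        Subterm u t →
        (∃ z, Subterm z t ∧ v = substFrom σ (.inl z)) ∨
        ∃ z α, Subterm z t ∧ z.label = .var α ∧
          ∃ y, IsChild y (σ α) ∧ Subterm v (substFrom σ (.inr y)) := by
      intro v w hvw
      induction hvw with
      | refl => exact fun u hu hut => Or.inl ⟨u, hut, hu⟩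
      | step hc hvw ih =>
        rintro u rfl hut
        rcases isChild_substFrom_inl hc with ⟨w, hw, rfl, -⟩ | ⟨α, w, hα, hw, rfl⟩
        · exact ih w rfl (Subterm.trans (.step hw (.refl _)) hut)
        · exact Or.inr ⟨u, α, hut, hα, w, hw, hvw⟩
    have hfin : ({v | ∃ z, Subterm z t ∧ v = substFrom σ (.inl z)} ∪
        ⋃ z ∈ {z | Subterm z t}, ⋃ y ∈ {y | ∃ α, z.label = .var α ∧ IsChild y (σ α)},
          {v | Subterm v (substFrom σ (.inr y))}).Finite := by
      refine Set.Finite.union ?_ (Set.Finite.biUnion h.1 fun z _ => Set.Finite.biUnion ?_ ?_)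
      · refine (h.1.image fun z => substFrom σ (.inl z)).subset ?_
        rintro v ⟨z, hz, rfl⟩
        exact ⟨z, hz, rfl⟩
      · by_cases hz : ∃ α, z.label = .var α
        · obtain ⟨α, hα⟩ := hz
          refine (hσ α).1.subset ?_
          rintro y ⟨β, hβ, hy⟩
          rw [hα] at hβ
          injection hβ with hβ
          subst hβ
          exact Subterm.step hy (Subterm.refl y)
        · refine Set.finite_empty.subset ?_
          rintro y ⟨α, hα, -⟩
          exact hz ⟨α, hα⟩
      · rintro y ⟨α, -, hy⟩
        exact (wf_substFrom_inr ((hσ α).child hy)).1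
    refine hfin.subset ?_
    intro v hv
    rcases key v _ hv t rfl (.refl _) with hz | ⟨z, α, hz, hα, y, hy, hv⟩
    · exact Or.inl hz
    · refine Or.inr ?_
      simp only [Set.mem_iUnion]
      exact ⟨z, hz, y, ⟨α, hα, hy⟩, hv⟩
  · intro br h0 hbr N
    by_cases hex : ∃ n u, (substFrom σ (.inr u)) = br n ∧ WF u
    · obtain ⟨n, u, hu, hwf⟩ := hex
      obtain ⟨m, hm, hl⟩ := (wf_substFrom_inr (σ := σ) hwf).2 (fun k => br (n + k)) hu.symm
        (fun k => hbr (n + k)) N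
      exact ⟨n + m, by omega, hl⟩
    · let C : Tree S → Tree S := fun z => substFrom σ (.inl z)
      have step : ∀ n z, br n = C z → ∃ w, IsChild w z ∧ br (n + 1) = C w ∧
          (C z).label = z.label := by
        intro n z hz
        rcases isChild_substFrom_inl ((congrArg (IsChild _) hz).mp (hbr n)) with hw | ⟨α, w, -, hw, hw'⟩
        · exact hw
        · exact absurd ⟨n + 1, w, hw'.symm, (hσ α).child hw⟩ hex
      let next : (n : ℕ) → {z // br n = C z} → {z // br (n + 1) = C z} := fun n z =>
        ⟨(step n z.1 z.2).choose, (step n z.1 z.2).choose_spec.2.1⟩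
      let st : (n : ℕ) → {z // br n = C z} := fun n => Nat.rec ⟨t, h0⟩ next n
      obtain ⟨n, hn, hl⟩ := h.2 (fun n => (st n).1) rfl
        (fun n => (step n (st n).1 (st n).2).choose_spec.1) N
      refine ⟨n, hn, ?_⟩
      rw [(st n).2, (step n (st n).1 (st n).2).choose_spec.2.2]
      exact hl

end Tree

/-- Types: the regular and contractive terms. -/
def Ty (S : Sig) : Type := {t : Tree S // t.WF}

/-- The top-level constructor of a type, with its immediate subterms. -/
inductive View (S : Sig) where
  | base (b : S.Base)
  | var (α : TVar)
  | arrow (t s : Ty S)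
  | prod (t s : Ty S)
  | or (t s : Ty S)
  | neg (t : Ty S)
  | empty

namespace Ty

variable {S : Sig}

def node (l : Label S) (f : Fin l.arity → Ty S) : Ty S :=
  ⟨PFunctor.M.mk ⟨l, fun i => (f i).1⟩, Tree.WF.of_children (by
    rintro u ⟨i, rfl⟩
    exact (f i).2)⟩

def base (b : S.Base) : Ty S := node (.base b) Fin.elim0
def var (α : TVar) : Ty S := node (.var α) Fin.elim0
def arrow (t s : Ty S) : Ty S := node .arrow (fun i : Fin 2 => if i = 0 then t else s)
def prod (t s : Ty S) : Ty S := node .prod (fun i : Fin 2 => if i = 0 then t else s)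
def or (t s : Ty S) : Ty S := node .or (fun i : Fin 2 => if i = 0 then t else s)
def neg (t : Ty S) : Ty S := node .neg (fun _ => t)
def empty : Ty S := node .empty Fin.elim0
def any : Ty S := neg empty
def and (t s : Ty S) : Ty S := neg (or (neg t) (neg s))
def diff (t s : Ty S) : Ty S := and t (neg s)

def child (t : Ty S) (i : Fin t.1.label.arity) : Ty S :=
  ⟨t.1.dest.2 i, t.2.child ⟨i, rfl⟩⟩

def view (t : Ty S) : View S :=
  match h : t.1.label with
  | .base b => .base b
  | .var α => .var α
  | .arrow => .arrow (t.child (Fin.cast (by rw [h]; rfl) (0 : Fin 2)))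
      (t.child (Fin.cast (by rw [h]; rfl) (1 : Fin 2)))
  | .prod => .prod (t.child (Fin.cast (by rw [h]; rfl) (0 : Fin 2)))
      (t.child (Fin.cast (by rw [h]; rfl) (1 : Fin 2)))
  | .or => .or (t.child (Fin.cast (by rw [h]; rfl) (0 : Fin 2)))
      (t.child (Fin.cast (by rw [h]; rfl) (1 : Fin 2)))
  | .neg => .neg (t.child (Fin.cast (by rw [h]; rfl) (0 : Fin 1)))
  | .empty => .empty

/-- `BoolSub u t`: `t` is a union or a negation, and `u` is an immediate subterm of it. -/
inductive BoolSub : Ty S → Ty S → Prop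
  | orL {t u v : Ty S} : t.view = .or u v → BoolSub u t
  | orR {t u v : Ty S} : t.view = .or u v → BoolSub v t
  | neg {t u : Ty S} : t.view = .neg u → BoolSub u t

theorem BoolSub.spec {u t : Ty S} (h : BoolSub u t) :
    Tree.IsChild u.1 t.1 ∧ t.1.label ≠ .arrow ∧ t.1.label ≠ .prod := by
  cases h with
  | orL h | orR h | neg h =>
    unfold view at h
    split at h <;> cases h
    rename_i hl
    exact ⟨⟨_, rfl⟩, by rw [hl]; simp⟩

theorem boolSub_wf : WellFounded (BoolSub (S := S)) := by
  rw [wellFounded_iff_isEmpty_descending_chain]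
  refine ⟨fun ⟨f, hf⟩ => ?_⟩
  obtain ⟨n, -, hl⟩ := (f 0).2.2 (fun n => (f n).1) rfl (fun n => (hf n).spec.1) 0
  rcases hl with hl | hl
  · exact (hf n).spec.2.1 hl
  · exact (hf n).spec.2.2 hl

/-- Application of a type substitution. -/
def subst (t : Ty S) (σ : TVar → Ty S) : Ty S :=
  ⟨t.1.subst fun α => (σ α).1, t.2.subst fun α => (σ α).2⟩

/-- The type variables that occur in a type. -/
def vars (t : Ty S) : Set TVar := {α | ∃ u, Tree.Subterm u t.1 ∧ u.label = .var α}

/-- The union of a finite family of types. -/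
def unionL : List (Ty S) → Ty S
  | [] => empty
  | [t] => t
  | t :: ts => or t (unionL ts)

/-- The intersection of a finite family of types. -/
def interL : List (Ty S) → Ty S
  | [] => any
  | [t] => t
  | t :: ts => and t (interL ts)

end Ty

/-! ### Set-theoretic interpretation and subtyping -/

/-- The interpretation domain. A finite relation is represented by a list of pairs, and `none`
stands for the error element `Ω`. -/
inductive Dom (S : Sig) where
  | const (c : S.Const) (L : Finset TVar)
  | pair (d₁ d₂ : Dom S) (L : Finset TVar)
  | fn (R : List (Dom S × Option (Dom S))) (L : Finset TVar)

def Dom.tags {S : Sig} : Dom S → Finset TVar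
  | .const _ L => L
  | .pair _ _ L => L
  | .fn _ L => L

theorem Dom.sizeOf_fst_lt {S : Sig} {R : List (Dom S × Option (Dom S))} {L : Finset TVar}
    {p : Dom S × Option (Dom S)} (h : p ∈ R) : sizeOf p.1 < sizeOf (Dom.fn R L) := by
  have h1 := List.sizeOf_lt_of_mem h
  have h2 : sizeOf p = 1 + sizeOf p.1 + sizeOf p.2 := rfl
  have h3 : sizeOf (Dom.fn R L) = 1 + sizeOf R + sizeOf L := by simp
  omega

theorem Dom.sizeOf_snd_lt {S : Sig} {R : List (Dom S × Option (Dom S))} {L : Finset TVar}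
    {p : Dom S × Option (Dom S)} (h : p ∈ R) {d : Dom S} (hd : p.2 = some d) :
    sizeOf d < sizeOf (Dom.fn R L) := by
  have h1 := List.sizeOf_lt_of_mem h
  have h2 : sizeOf p = 1 + sizeOf p.1 + sizeOf p.2 := rfl
  have h3 : sizeOf (Dom.fn R L) = 1 + sizeOf R + sizeOf L := by simp
  have h4 : sizeOf (some d) = 1 + sizeOf d := rfl
  rw [hd, h4] at h2
  omega

instance (S : Sig) : WellFoundedRelation (Ty S) := ⟨Ty.BoolSub, Ty.boolSub_wf⟩

/-- The element `d` of the domain belongs to the type `t`. -/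
def Mem {S : Sig} (d : Dom S) (t : Ty S) : Prop :=
  match h : t.view with
  | .empty => False
  | .var α => α ∈ d.tags
  | .or u v => Mem d u ∨ Mem d v
  | .neg u => ¬ Mem d u
  | .base b =>
    match d with
    | .const c _ => c ∈ S.consts b
    | _ => False
  | .prod u v =>
    match d with
    | .pair d₁ d₂ _ => Mem d₁ u ∧ Mem d₂ v
    | _ => False
  | .arrow u v =>
    match d with
    | .fn R _ => ∀ p, ∀ _hp : p ∈ R, Mem p.1 u → ∃ d', ∃ _hd : p.2 = some d', Mem d' v
    | _ => False
termination_by (sizeOf d, t)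
decreasing_by
  · exact Prod.Lex.right _ (.orL h)
  · exact Prod.Lex.right _ (.orR h)
  · exact Prod.Lex.right _ (.neg h)
  · exact Prod.Lex.left _ _ (by simp; omega)
  · exact Prod.Lex.left _ _ (by simp; omega)
  · exact Prod.Lex.left _ _ (Dom.sizeOf_fst_lt _hp)
  · exact Prod.Lex.left _ _ (Dom.sizeOf_snd_lt _hp _hd)

/-- Subtyping. -/
def Ty.Sub {S : Sig} (t s : Ty S) : Prop := ∀ d, Mem d t → Mem d s

/-- Subtyping equivalence. -/
def Ty.Equiv {S : Sig} (t s : Ty S) : Prop := t.Sub s ∧ s.Sub t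

/-! ### Expressions in canonical form -/

/-- Types that can be tested by a type-case. -/
inductive TestTy (S : Sig) where
  | base (b : S.Base)
  | fn
  | prod (τ τ' : TestTy S)
  | or (τ τ' : TestTy S)
  | neg (τ : TestTy S)
  | empty

def TestTy.toTy {S : Sig} : TestTy S → Ty S
  | .base b => Ty.base b
  | .fn => Ty.arrow Ty.empty Ty.any
  | .prod τ τ' => Ty.prod τ.toTy τ'.toTy
  | .or τ τ' => Ty.or τ.toTy τ'.toTy
  | .neg τ => Ty.neg τ.toTy
  | .empty => Ty.empty

mutual

/-- Atoms. Lambda variables and binding variables are both named by natural numbers; they live in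
disjoint name spaces. In `proj i x`, the projection is the first one for `i = 0`. -/
inductive Atom (S : Sig) where
  | const (c : S.Const)
  | lvar (x : ℕ)
  | lam (x : ℕ) (κ : Form S)
  | pair (x₁ x₂ : ℕ)
  | app (x₁ x₂ : ℕ)
  | proj (i : Fin 2) (x : ℕ)
  | tcase (x : ℕ) (τ : TestTy S) (x₁ x₂ : ℕ)

/-- Canonical forms. -/
inductive Form (S : Sig) where
  | bvar (x : ℕ)
  | bind (x : ℕ) (a : Atom S) (κ : Form S)

end

/-- Either an atom or a canonical form. -/
inductive Expr (S : Sig) where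
  | atom (a : Atom S)
  | form (κ : Form S)

/-! ### Environments and substitutions -/

/-- Variables of environments: lambda variables and binding variables. -/
inductive Var where
  | lam (n : ℕ)
  | bnd (n : ℕ)
deriving DecidableEq

/-- Type environments: finite maps from variables to types. -/
abbrev Env (S : Sig) : Type := Finmap fun _ : Var => Ty S

abbrev Subst (S : Sig) : Type := TVar → Ty S

section

variable {S : Sig}

def Env.vars (Γ : Env S) : Set TVar := {α | ∃ x t, Γ.lookup x = some t ∧ α ∈ t.vars}

/-- The environment `{x : t} ∧ {y : s}`, for binding variables `x` and `y`. -/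
def Env.pair (x : ℕ) (t : Ty S) (y : ℕ) (s : Ty S) : Env S :=
  if x = y then Finmap.singleton (.bnd x) (t.and s)
  else (Finmap.singleton (.bnd x) t).insert (.bnd y) s

/-- Application of a substitution to an environment. -/
def Env.subst (Γ : Env S) (σ : Subst S) : Env S :=
  ⟨Γ.entries.map fun e => ⟨e.1, e.2.subst σ⟩, by
    have h : (Γ.entries.map fun e => (⟨e.1, e.2.subst σ⟩ : (_ : Var) × Ty S)).keys =
        Γ.entries.keys := by
      simp [Multiset.keys, Multiset.map_map]
    rw [← Multiset.nodup_keys, h, Multiset.nodup_keys]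
    exact Γ.nodupKeys⟩

/-- The restriction of an environment to the bindings that satisfy a property. -/
noncomputable def Env.filter (Γ : Env S) (P : Var → Ty S → Prop) : Env S :=
  ⟨@Multiset.filter _ (fun e => P e.1 e.2) (Classical.decPred _) Γ.entries, by
    rw [← Multiset.nodup_keys]
    exact Multiset.nodup_of_le (Multiset.map_le_map (@Multiset.filter_le _ _ (Classical.decPred _) _))
      (Multiset.nodup_keys.2 Γ.nodupKeys)⟩

def Subst.dom (σ : Subst S) : Set TVar := {α | σ α ≠ Ty.var α}

/-- The substitution `σ ∘ ρ`, which applies `ρ` first. -/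
def Subst.comp (σ ρ : Subst S) : Subst S := fun α => (ρ α).subst σ

/-- `σ # Γ`: no type variable of `Γ` is in the domain of `σ`. -/
def Subst.Disj (σ : Subst S) (Γ : Env S) : Prop := σ.dom ∩ Γ.vars = ∅

/-- The application of a set of substitutions to a type. -/
def Ty.inst (t : Ty S) (Sg : List (Subst S)) : Ty S := Ty.interL (Sg.map fun σ => t.subst σ)

def polyVars : Set TVar := {α | ∃ n, α = .poly n}

/-- `ρ` renames the polymorphic variables of `t` to distinct polymorphic variables that are not in
`avoid`. -/
structure IsFreshRenaming (avoid : Set TVar) (t : Ty S) (ρ : Subst S) : Prop where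
  fresh : ∀ α ∈ t.vars ∩ polyVars, ∃ β ∈ polyVars, β ∉ avoid ∧ ρ α = Ty.var β
  inj : ∀ α ∈ t.vars ∩ polyVars, ∀ β ∈ t.vars ∩ polyVars, ρ α = ρ β → α = β
  id : ∀ α, α ∉ t.vars ∩ polyVars → ρ α = Ty.var α

/-! ### Tallying -/

/-- The finite set `Sg` of substitutions is a principal solution of the tallying problem `t ≤ s`, in
which the variables in `V` can be instantiated. -/
structure IsTallyOn (V : Set TVar) (t s : Ty S) (Sg : List (Subst S)) : Prop where
  dom : ∀ σ ∈ Sg, σ.dom ⊆ V ∩ (t.vars ∪ s.vars)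
  sound : ∀ σ ∈ Sg, (t.subst σ).Sub (s.subst σ)
  complete : ∀ σ' : Subst S, σ'.dom ⊆ V → (t.subst σ').Sub (s.subst σ') →
    ∃ σ ∈ Sg, ∃ σ'' : Subst S, σ''.dom ⊆ V ∧
      ∀ α ∈ t.vars ∪ s.vars, (σ' α).Equiv ((σ α).subst σ'')

/-- Tallying: only the polymorphic variables can be instantiated. -/
def IsTally (t s : Ty S) (Sg : List (Subst S)) : Prop := IsTallyOn polyVars t s Sg

/-- `ψ` is the restriction of `θ` to monomorphic variables, in which the polymorphic variables of
the images are replaced by fresh monomorphic variables. -/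
def IsMonoPart (avoid : Set TVar) (V : Set TVar) (θ ψ : Subst S) : Prop :=
  ∃ η : ℕ → ℕ, Function.Injective η ∧
    (∀ n, .mono (η n) ∉ avoid ∪ V ∧ ∀ m, .mono m ∈ V → .mono (η n) ∉ (θ (.mono m)).vars) ∧
    ∀ α, ψ α = match α with
      | .poly n => Ty.var (.poly n)
      | .mono m => (θ (.mono m)).subst fun β => match β with
        | .poly n => Ty.var (.mono (η n))
        | .mono n => Ty.var (.mono n)

/-- Inference of substitutions for the monomorphic variables: the tallying problem `t ≤ s` is
solved for all type variables (the polymorphic ones of `t` and of `s` being renamed apart), and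
each solution is turned into a substitution from monomorphic variables to monomorphic types. -/
def IsTallyInfer (avoid : Set TVar) (t s : Ty S) (Ps : List (Subst S)) : Prop :=
  ∃ ρ₁ ρ₂ Th,
    IsFreshRenaming (avoid ∪ t.vars ∪ s.vars) t ρ₁ ∧
    IsFreshRenaming (avoid ∪ t.vars ∪ s.vars ∪ (t.subst ρ₁).vars) s ρ₂ ∧
    IsTallyOn Set.univ (t.subst ρ₁) (s.subst ρ₂) Th ∧
    List.Forall₂ (IsMonoPart avoid (t.vars ∪ s.vars)) Th Ps

/-! ### Type operators and disjunctive normal forms -/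

/-- `u` is the domain of `t`. -/
def IsDomain (t u : Ty S) : Prop :=
  t.Sub (u.arrow .any) ∧ ∀ u' : Ty S, t.Sub (u'.arrow .any) → u'.Sub u

/-- `u` is the type of the application of a function of type `t` to an argument of type `s`. -/
def IsApply (t s u : Ty S) : Prop :=
  t.Sub (s.arrow u) ∧ ∀ u' : Ty S, t.Sub (s.arrow u') → u.Sub u'

/-- The product type with `u` as `i`-th component and the top type as the other one. -/
def Ty.projTy (i : Fin 2) (u : Ty S) : Ty S := if i = 0 then u.prod .any else Ty.prod .any u

/-- `u` is the `i`-th projection of `t`. -/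
def IsProj (i : Fin 2) (t u : Ty S) : Prop :=
  t.Sub (u.projTy i) ∧ ∀ u' : Ty S, t.Sub (u'.projTy i) → u.Sub u'

def Ty.IsTypeAtom (t : Ty S) : Prop :=
  (∃ b, t = .base b) ∨ (∃ α, t = .var α) ∨ (∃ u v, t = .arrow u v) ∨ ∃ u v, t = .prod u v

def Ty.IsLiteral (t : Ty S) : Prop := t.IsTypeAtom ∨ ∃ u : Ty S, u.IsTypeAtom ∧ t = u.neg

def Ty.IsClause (t : Ty S) : Prop := ∃ ls : List (Ty S), (∀ l ∈ ls, l.IsLiteral) ∧ t = .interL ls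

/-- `ts` are the summands of a disjunctive normal form of `t`. -/
def IsDNF (t : Ty S) (ts : List (Ty S)) : Prop := (∀ u ∈ ts, u.IsClause) ∧ t.Equiv (.unionL ts)

/-- The clause `t` has a top-level type variable, or does not contain any pair. -/
def Ty.IsNonProduct (t : Ty S) : Prop :=
  (∃ ls : List (Ty S), (∀ l ∈ ls, l.IsLiteral) ∧ t = .interL ls ∧
    ∃ α, .var α ∈ ls ∨ Ty.neg (.var α) ∈ ls) ∨
  (t.and (.prod .any .any)).Equiv .empty

/-- `ps` are the products in a disjunctive normal form of `t`. -/
def IsPairDNF (t : Ty S) (ps : List (Ty S × Ty S)) : Prop :=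
  ∃ rest : List (Ty S), IsDNF t (ps.map (fun p => p.1.prod p.2) ++ rest) ∧
    ∀ u ∈ rest, u.IsNonProduct

/-! ### Algorithmic type system -/

/-- Annotations of the algorithmic system, for atoms (first group) and forms (second group), and
intersections for both. Finite sets are represented by lists. -/
inductive AAnn (S : Sig) where
  | none
  | lam (t : Ty S) (k : AAnn S)
  | pair (ρ₁ ρ₂ : Subst S)
  | app (Sg₁ Sg₂ : List (Subst S))
  | proj (Sg : List (Subst S))
  | empty (Sg : List (Subst S))
  | then_ (Sg : List (Subst S))
  | else_ (Sg : List (Subst S))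
  | var (ρ : Subst S)
  | keep (a : AAnn S) (ks : List (Ty S × AAnn S))
  | skip (k : AAnn S)
  | inter (as : List (AAnn S))

/-- The judgments of the algorithmic type system. In the rules with a family of premises, the list
`l` carries the members of the family. -/
inductive HasTy : Env S → Expr S → AAnn S → Ty S → Prop
  | const {Γ c} : HasTy Γ (.atom (.const c)) .none (.base (S.basic c))
  | ax {Γ x t} : Γ.lookup (.lam x) = some t → HasTy Γ (.atom (.lvar x)) .none t
  | arrowI {Γ x κ u k t} : HasTy (Γ.insert (.lam x) u) (.form κ) k t →
      HasTy Γ (.atom (.lam x κ)) (.lam u k) (u.arrow t)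
  | arrowE {Γ x₁ x₂ s₁ s₂ Sg₁ Sg₂ u t} :
      Γ.lookup (.bnd x₁) = some s₁ → Γ.lookup (.bnd x₂) = some s₂ →
      (s₁.inst Sg₁).Sub (.arrow .empty .any) →
      IsDomain (s₁.inst Sg₁) u → (s₂.inst Sg₂).Sub u →
      IsApply (s₁.inst Sg₁) (s₂.inst Sg₂) t →
      HasTy Γ (.atom (.app x₁ x₂)) (.app Sg₁ Sg₂) t
  | prodI {Γ x₁ x₂ s₁ s₂ ρ₁ ρ₂} :
      Γ.lookup (.bnd x₁) = some s₁ → Γ.lookup (.bnd x₂) = some s₂ →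
      HasTy Γ (.atom (.pair x₁ x₂)) (.pair ρ₁ ρ₂) ((s₁.subst ρ₁).prod (s₂.subst ρ₂))
  | prodE {Γ i x s Sg t} :
      Γ.lookup (.bnd x) = some s → (s.inst Sg).Sub (.prod .any .any) → IsProj i (s.inst Sg) t →
      HasTy Γ (.atom (.proj i x)) (.proj Sg) t
  | caseEmpty {Γ x τ x₁ x₂ s Sg} :
      Γ.lookup (.bnd x) = some s → (s.inst Sg).Equiv .empty →
      HasTy Γ (.atom (.tcase x τ x₁ x₂)) (.empty Sg) .empty
  | caseThen {Γ x τ x₁ x₂ s Sg t} :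
      Γ.lookup (.bnd x) = some s → (s.inst Sg).Sub τ.toTy → Γ.lookup (.bnd x₁) = some t →
      HasTy Γ (.atom (.tcase x τ x₁ x₂)) (.then_ Sg) t
  | caseElse {Γ x τ x₁ x₂ s Sg t} :
      Γ.lookup (.bnd x) = some s → (s.inst Sg).Sub τ.toTy.neg → Γ.lookup (.bnd x₂) = some t →
      HasTy Γ (.atom (.tcase x τ x₁ x₂)) (.else_ Sg) t
  | var {Γ x t ρ} : Γ.lookup (.bnd x) = some t →
      HasTy Γ (.form (.bvar x)) (.var ρ) (t.subst ρ)
  | bindSkip {Γ x a κ k t} : Var.bnd x ∉ Γ → HasTy Γ (.form κ) k t →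
      HasTy Γ (.form (.bind x a κ)) (.skip k) t
  | bindKeep {Γ x a κ aa s} (l : List (Ty S × AAnn S × Ty S)) :
      HasTy Γ (.atom a) aa s →
      (∀ p ∈ l, HasTy (Γ.insert (.bnd x) (s.and p.1)) (.form κ) p.2.1 p.2.2) →
      (Ty.unionL (l.map fun p => p.1)).Equiv .any →
      HasTy Γ (.form (.bind x a κ)) (.keep aa (l.map fun p => (p.1, p.2.1)))
        (.unionL (l.map fun p => p.2.2))
  | inter {Γ η} (l : List (AAnn S × Ty S)) : l ≠ [] → (∀ p ∈ l, HasTy Γ η p.1 p.2) →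
      HasTy Γ η (.inter (l.map fun p => p.1)) (.interL (l.map fun p => p.2))

/-! ### Intermediate annotations and results -/

/-- Intermediate annotations. Those of atoms and those of forms are put in the same class: no rule
applies to an annotation that does not fit the expression. Finite sets are represented by lists,
modulo the equivalence `Ann.Eqv` below. -/
inductive Ann (S : Sig) where
  | infer
  | untyp
  | typ
  | inter (S₁ S₂ : List (Ann S))
  | then_
  | else_
  | lam (t : Ty S) (B : Ann S)
  | trySkip (B : Ann S)
  | tryKeep (A B₁ B₂ : Ann S)
  | prop (A : Ann S) (Gs : List (Env S)) (S₁ S₂ : List (Ty S × Ann S))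
  | skip (B : Ann S)
  | keep (A : Ann S) (S₁ S₂ : List (Ty S × Ann S))

/-- The lists `l.map f` and `L` have the same elements. -/
def SameElems {X Y : Type} (l : List X) (f : X → Y) (L : List Y) : Prop :=
  ∀ y, y ∈ L ↔ ∃ x ∈ l, f x = y

/-- Equality of annotations, in which the lists are compared as sets. Two sets are equal if they are
the two projections of a set `l₁` (or `l₂`) of pairs of equal elements. -/
inductive Ann.Eqv : Ann S → Ann S → Prop
  | infer : Eqv .infer .infer
  | untyp : Eqv .untyp .untyp
  | typ : Eqv .typ .typ
  | inter {S₁ S₂ S₁' S₂' : List (Ann S)} (l₁ l₂ : List (Ann S × Ann S)) :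
      (∀ p ∈ l₁, Eqv p.1 p.2) →
      SameElems l₁ (fun p => p.1) S₁ → SameElems l₁ (fun p => p.2) S₁' →
      (∀ p ∈ l₂, Eqv p.1 p.2) →
      SameElems l₂ (fun p => p.1) S₂ → SameElems l₂ (fun p => p.2) S₂' →
      Eqv (.inter S₁ S₂) (.inter S₁' S₂')
  | then_ : Eqv .then_ .then_
  | else_ : Eqv .else_ .else_
  | lam {t : Ty S} {B B' : Ann S} : Eqv B B' → Eqv (.lam t B) (.lam t B')
  | trySkip {B B' : Ann S} : Eqv B B' → Eqv (.trySkip B) (.trySkip B')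
  | tryKeep {A A' B₁ B₁' B₂ B₂' : Ann S} : Eqv A A' → Eqv B₁ B₁' → Eqv B₂ B₂' →
      Eqv (.tryKeep A B₁ B₂) (.tryKeep A' B₁' B₂')
  | prop {A A' : Ann S} {Gs Gs' : List (Env S)} {S₁ S₂ S₁' S₂' : List (Ty S × Ann S)}
      (l₁ l₂ : List (Ty S × Ann S × Ann S)) :
      Eqv A A' → (∀ G, G ∈ Gs ↔ G ∈ Gs') →
      (∀ p ∈ l₁, Eqv p.2.1 p.2.2) →
      SameElems l₁ (fun p => (p.1, p.2.1)) S₁ → SameElems l₁ (fun p => (p.1, p.2.2)) S₁' →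
      (∀ p ∈ l₂, Eqv p.2.1 p.2.2) →
      SameElems l₂ (fun p => (p.1, p.2.1)) S₂ → SameElems l₂ (fun p => (p.1, p.2.2)) S₂' →
      Eqv (.prop A Gs S₁ S₂) (.prop A' Gs' S₁' S₂')
  | skip {B B' : Ann S} : Eqv B B' → Eqv (.skip B) (.skip B')
  | keep {A A' : Ann S} {S₁ S₂ S₁' S₂' : List (Ty S × Ann S)}
      (l₁ l₂ : List (Ty S × Ann S × Ann S)) :
      Eqv A A' →
      (∀ p ∈ l₁, Eqv p.2.1 p.2.2) →
      SameElems l₁ (fun p => (p.1, p.2.1)) S₁ → SameElems l₁ (fun p => (p.1, p.2.2)) S₁' →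
      (∀ p ∈ l₂, Eqv p.2.1 p.2.2) →
      SameElems l₂ (fun p => (p.1, p.2.1)) S₂ → SameElems l₂ (fun p => (p.1, p.2.2)) S₂' →
      Eqv (.keep A S₁ S₂) (.keep A' S₁' S₂')

/-- The set `L` without the annotation `A`. -/
noncomputable def Ann.remove (L : List (Ann S)) (A : Ann S) : List (Ann S) :=
  open Classical in L.filter fun A' => ¬ A.Eqv A'

/-- The set `L` without the split `p`. -/
noncomputable def Ann.removeSplit (L : List (Ty S × Ann S)) (p : Ty S × Ann S) :
    List (Ty S × Ann S) :=
  open Classical in L.filter fun p' => ¬ (p.1 = p'.1 ∧ p.2.Eqv p'.2)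

/-- The set `L` without the environment `G`. -/
noncomputable def Ann.removeEnv (L : List (Env S)) (G : Env S) : List (Env S) :=
  open Classical in L.filter fun G' => G' ≠ G

mutual

/-- Application of a substitution to every type of an annotation. -/
def Ann.subst (σ : Subst S) : Ann S → Ann S
  | .infer => .infer
  | .untyp => .untyp
  | .typ => .typ
  | .inter S₁ S₂ => .inter (Ann.substList σ S₁) (Ann.substList σ S₂)
  | .then_ => .then_
  | .else_ => .else_
  | .lam t B => .lam (t.subst σ) (Ann.subst σ B)
  | .trySkip B => .trySkip (Ann.subst σ B)
  | .tryKeep A B₁ B₂ => .tryKeep (Ann.subst σ A) (Ann.subst σ B₁) (Ann.subst σ B₂)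
  | .prop A Gs S₁ S₂ => .prop (Ann.subst σ A) (Gs.map fun G => G.subst σ)
      (Ann.substSplits σ S₁) (Ann.substSplits σ S₂)
  | .skip B => .skip (Ann.subst σ B)
  | .keep A S₁ S₂ => .keep (Ann.subst σ A) (Ann.substSplits σ S₁) (Ann.substSplits σ S₂)

def Ann.substList (σ : Subst S) : List (Ann S) → List (Ann S)
  | [] => []
  | A :: L => Ann.subst σ A :: Ann.substList σ L

def Ann.substSplits (σ : Subst S) : List (Ty S × Ann S) → List (Ty S × Ann S)
  | [] => []
  | (t, B) :: L => (t.subst σ, Ann.subst σ B) :: Ann.substSplits σ L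

end

/-- Results of the reconstruction. In `part` the environment maps variables to the types that split
them, and in `subst` the set of substitutions is represented by a list. -/
inductive Res (S : Sig) where
  | ok (A : Ann S)
  | fail
  | part (G : Env S) (A₁ A₂ : Ann S)
  | subst (Ps : List (Subst S)) (A₁ A₂ : Ann S)
  | var (x : ℕ) (A₁ A₂ : Ann S)

/-- Application of a function to each intermediate annotation of a result. -/
def Res.map (f : Ann S → Ann S) : Res S → Res S
  | .ok A => .ok (f A)
  | .fail => .fail
  | .part G A₁ A₂ => .part G (f A₁) (f A₂)
  | .subst Ps A₁ A₂ => .subst Ps (f A₁) (f A₂)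
  | .var x A₁ A₂ => .var x (f A₁) (f A₂)

/-! ### Auxiliary reconstruction system -/

/-- `Aux Γ η A a`: the intermediate annotation `A` of the expression `η` is converted into the
annotation `a` of the algorithmic system. -/
inductive Aux : Env S → Expr S → Ann S → AAnn S → Prop
  | const {Γ c} : Aux Γ (.atom (.const c)) .typ .none
  | ax {Γ x} : Var.lam x ∈ Γ → Aux Γ (.atom (.lvar x)) .typ .none
  | pair {Γ x₁ x₂ t₁ t₂ ρ₁ ρ₂} :
      Γ.lookup (.bnd x₁) = some t₁ → Γ.lookup (.bnd x₂) = some t₂ →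
      IsFreshRenaming Γ.vars t₁ ρ₁ → IsFreshRenaming (Γ.vars ∪ (t₁.subst ρ₁).vars) t₂ ρ₂ →
      Aux Γ (.atom (.pair x₁ x₂)) .typ (.pair ρ₁ ρ₂)
  | proj {Γ i x t α β Sg} :
      Γ.lookup (.bnd x) = some t →
      .poly α ∉ Γ.vars → .poly β ∉ Γ.vars → α ≠ β →
      IsTally t (.prod (.var (.poly α)) (.var (.poly β))) Sg → Sg ≠ [] →
      Aux Γ (.atom (.proj i x)) .typ (.proj Sg)
  | app {Γ x₁ x₂ t₁ t₂ ρ₁ ρ₂ α Sg} :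
      Γ.lookup (.bnd x₁) = some t₁ → Γ.lookup (.bnd x₂) = some t₂ →
      IsFreshRenaming Γ.vars t₁ ρ₁ → IsFreshRenaming (Γ.vars ∪ (t₁.subst ρ₁).vars) t₂ ρ₂ →
      .poly α ∉ Γ.vars ∪ (t₁.subst ρ₁).vars ∪ (t₂.subst ρ₂).vars →
      IsTally (t₁.subst ρ₁) ((t₂.subst ρ₂).arrow (.var (.poly α))) Sg → Sg ≠ [] →
      Aux Γ (.atom (.app x₁ x₂)) .typ
        (.app (Sg.map fun σ => σ.comp ρ₁) (Sg.map fun σ => σ.comp ρ₂))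
  | caseEmpty {Γ x τ x₁ x₂ t Sg σ} :
      Γ.lookup (.bnd x) = some t → IsTally t .empty Sg → σ ∈ Sg →
      Aux Γ (.atom (.tcase x τ x₁ x₂)) .typ (.empty [σ])
  | case₁ {Γ x τ x₁ x₂ t Sg σ} :
      Γ.lookup (.bnd x) = some t → IsTally t τ.toTy Sg → σ ∈ Sg → Var.bnd x₁ ∈ Γ →
      Aux Γ (.atom (.tcase x τ x₁ x₂)) .typ (.then_ [σ])
  | case₂ {Γ x τ x₁ x₂ t Sg σ} :
      Γ.lookup (.bnd x) = some t → IsTally t τ.toTy.neg Sg → σ ∈ Sg → Var.bnd x₂ ∈ Γ →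
      Aux Γ (.atom (.tcase x τ x₁ x₂)) .typ (.else_ [σ])
  | lam {Γ x κ u B k} : Aux (Γ.insert (.lam x) u) (.form κ) B k →
      Aux Γ (.atom (.lam x κ)) (.lam u B) (.lam u k)
  | var {Γ x t ρ} : Γ.lookup (.bnd x) = some t → IsFreshRenaming Γ.vars t ρ →
      Aux Γ (.form (.bvar x)) .typ (.var ρ)
  | bindSkip {Γ x a κ B k} : Var.bnd x ∉ Γ → Aux Γ (.form κ) B k →
      Aux Γ (.form (.bind x a κ)) (.skip B) (.skip k)
  | bindKeep {Γ x a κ A aa s} (l : List (Ty S × Ann S × AAnn S)) :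
      Aux Γ (.atom a) A aa → HasTy Γ (.atom a) aa s →
      (∀ p ∈ l, Aux (Γ.insert (.bnd x) (s.and p.1)) (.form κ) p.2.1 p.2.2) →
      (Ty.unionL (l.map fun p => p.1)).Equiv .any →
      Aux Γ (.form (.bind x a κ)) (.keep A [] (l.map fun p => (p.1, p.2.1)))
        (.keep aa (l.map fun p => (p.1, p.2.2)))
  | inter {Γ η} (l : List (Ann S × AAnn S)) : l ≠ [] → (∀ p ∈ l, Aux Γ η p.1 p.2) →
      Aux Γ η (.inter [] (l.map fun p => p.1)) (.inter (l.map fun p => p.2))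

/-! ### Split propagation system -/

/-- `Occurs pos α t`: the variable `α` has an occurrence in `t` in a covariant position (for
`pos = true`) or in a contravariant position (for `pos = false`). -/
inductive Occurs : Bool → TVar → Ty S → Prop
  | var {α} : Occurs true α (.var α)
  | arrowL {p α t s} : Occurs p α t → Occurs (!p) α (.arrow t s)
  | arrowR {p α t s} : Occurs p α s → Occurs p α (.arrow t s)
  | prodL {p α t s} : Occurs p α t → Occurs p α (.prod t s)
  | prodR {p α t s} : Occurs p α s → Occurs p α (.prod t s)
  | orL {p α t s} : Occurs p α t → Occurs p α (.or t s)
  | orR {p α t s} : Occurs p α s → Occurs p α (.or t s)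
  | neg {p α t} : Occurs p α t → Occurs (!p) α (.neg t)

/-- `σ'` eliminates the polymorphic variables of `t` and `u`: those that are not contravariant in
`u` become the top type, the other ones that are not covariant in `u` become the empty type, and
the remaining ones become distinct monomorphic variables that are not in `avoid`. -/
structure IsPolyElim (avoid : Set TVar) (t u : Ty S) (σ' : Subst S) : Prop where
  top : ∀ α ∈ (t.vars ∪ u.vars) ∩ polyVars, ¬ Occurs false α u → σ' α = .any
  bot : ∀ α ∈ (t.vars ∪ u.vars) ∩ polyVars, Occurs false α u → ¬ Occurs true α u → σ' α = .empty
  fresh : ∀ α ∈ (t.vars ∪ u.vars) ∩ polyVars, Occurs false α u → Occurs true α u →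
    ∃ n, .mono n ∉ avoid ∪ t.vars ∪ u.vars ∧ σ' α = .var (.mono n)
  inj : ∀ α β, Occurs false α u → Occurs true α u → Occurs false β u → Occurs true β u →
    α ∈ polyVars → β ∈ polyVars → σ' α = σ' β → α = β
  id : ∀ α, α ∉ (t.vars ∪ u.vars) ∩ polyVars → σ' α = .var α

/-- `Split Γ a t Gs`: each environment of the finite set `Gs` gives additional assumptions on `Γ`
that aim at ensuring that `a` has type `t`. -/
inductive Split : Env S → Atom S → Ty S → List (Env S) → Prop
  | const₁ {Γ c t} : (Ty.base (S.basic c)).Sub t → Split Γ (.const c) t [∅]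
  | const₂ {Γ c t} : ¬ (Ty.base (S.basic c)).Sub t → Split Γ (.const c) t []
  | ax₁ {Γ x t s} : Γ.lookup (.lam x) = some s → s.Sub t → Split Γ (.lvar x) t [∅]
  | ax₂ {Γ x t} : (∀ s, Γ.lookup (.lam x) = some s → ¬ s.Sub t) → Split Γ (.lvar x) t []
  | proj {Γ i x t} : Split Γ (.proj i x) t [Finmap.singleton (.bnd x) (t.projTy i)]
  | pair {Γ x₁ x₂ t} {ps : List (Ty S × Ty S)} : IsPairDNF t ps →
      Split Γ (.pair x₁ x₂) t (ps.map fun p => Env.pair x₁ p.1 x₂ p.2)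
  | tcase {Γ x τ x₁ x₂ t} : Split Γ (.tcase x τ x₁ x₂) t
      [Env.pair x τ.toTy x₁ t, Env.pair x τ.toTy.neg x₂ t]
  | app {Γ x₁ x₂ t s α} {ts : List (Ty S)} {Gss : List (List (Env S))} :
      Γ.lookup (.bnd x₁) = some s → IsDNF s ts →
      .poly α ∉ Γ.vars ∪ t.vars → (∀ u ∈ ts, .poly α ∉ u.vars) →
      List.Forall₂ (fun u Gs => ∃ Sg, IsTally u (.arrow (.var (.poly α)) t) Sg ∧
        List.Forall₂ (fun (σ : Subst S) G => ∃ σ' : Subst S,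
          IsPolyElim (Γ.vars ∪ t.vars) (u.subst σ) (σ (.poly α)) σ' ∧
          G = Env.pair x₁ ((u.subst σ).subst σ') x₂ ((σ (.poly α)).subst σ')) Sg Gs) ts Gss →
      Split Γ (.app x₁ x₂) t Gss.flatten
  | lam {Γ x κ t} : Split Γ (.lam x κ) t []

/-! ### Main reconstruction system -/

/-- The two main judgments: the one without iteration and the one with iteration. -/
inductive Mode where
  | plain
  | iter

/-- The input of a main judgment. -/
structure Call (S : Sig) where
  mode : Mode
  env : Env S
  expr : Expr S
  ann : Ann S

/-- A type environment is compatible with a set of additional assumptions. -/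
def Compatible (Γ G : Env S) : Prop :=
  ∀ x t, G.lookup x = some t → ∃ s, Γ.lookup x = some s ∧
    (¬ (s.and t).Equiv .empty ∨ s.Equiv .empty)

/-- The result can be handled by an iteration in the environment `Γ`. -/
def Res.Iterable (Γ : Env S) : Res S → Prop
  | .part G _ _ => G = ∅
  | .subst Ps _ _ => ∀ ψ ∈ Ps, Subst.Disj ψ Γ
  | _ => False

/-- The instances of the deduction rules for the two main judgments: `Rule c ps r` means that the
judgment with input `c` and result `r` is the conclusion of an instance whose premises that are main
judgments are, from left to right, those of the list `ps`. The other premises and the guards are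
hypotheses of the constructors. The rules are given by decreasing priority, and a rule has the
additional guards which say that no rule of higher priority can be used. -/
inductive Rule : Call S → List (Call S × Res S) → Res S → Prop
  | ok {Γ η} : Rule ⟨.plain, Γ, η, .typ⟩ [] (.ok .typ)
  | fail {Γ η} : Rule ⟨.plain, Γ, η, .untyp⟩ [] .fail
  | const {Γ c} : Rule ⟨.plain, Γ, .atom (.const c), .infer⟩ [] (.ok .typ)
  | axOk {Γ x} : Var.lam x ∈ Γ → Rule ⟨.plain, Γ, .atom (.lvar x), .infer⟩ [] (.ok .typ)
  | axFail {Γ x} : Var.lam x ∉ Γ → Rule ⟨.plain, Γ, .atom (.lvar x), .infer⟩ [] .fail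
  | pairVar₁ {Γ x₁ x₂} : Var.bnd x₁ ∉ Γ →
      Rule ⟨.plain, Γ, .atom (.pair x₁ x₂), .infer⟩ [] (.var x₁ .infer .untyp)
  | pairVar₂ {Γ x₁ x₂} : Var.bnd x₁ ∈ Γ → Var.bnd x₂ ∉ Γ →
      Rule ⟨.plain, Γ, .atom (.pair x₁ x₂), .infer⟩ [] (.var x₂ .infer .untyp)
  | pairOk {Γ x₁ x₂} : Var.bnd x₁ ∈ Γ → Var.bnd x₂ ∈ Γ →
      Rule ⟨.plain, Γ, .atom (.pair x₁ x₂), .infer⟩ [] (.ok .typ)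
  | projVar {Γ i x} : Var.bnd x ∉ Γ →
      Rule ⟨.plain, Γ, .atom (.proj i x), .infer⟩ [] (.var x .infer .untyp)
  | projInfer {Γ i x t α β Ps} : Γ.lookup (.bnd x) = some t →
      .poly α ∉ Γ.vars → .poly β ∉ Γ.vars → α ≠ β →
      IsTallyInfer Γ.vars t (.prod (.var (.poly α)) (.var (.poly β))) Ps →
      Rule ⟨.plain, Γ, .atom (.proj i x), .infer⟩ [] (.subst Ps .typ .untyp)
  | appVar₁ {Γ x₁ x₂} : Var.bnd x₁ ∉ Γ →
      Rule ⟨.plain, Γ, .atom (.app x₁ x₂), .infer⟩ [] (.var x₁ .infer .untyp)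
  | appVar₂ {Γ x₁ x₂} : Var.bnd x₁ ∈ Γ → Var.bnd x₂ ∉ Γ →
      Rule ⟨.plain, Γ, .atom (.app x₁ x₂), .infer⟩ [] (.var x₂ .infer .untyp)
  | appInfer {Γ x₁ x₂ t₁ t₂ α Ps} :
      Γ.lookup (.bnd x₁) = some t₁ → Γ.lookup (.bnd x₂) = some t₂ → .poly α ∉ Γ.vars →
      IsTallyInfer Γ.vars t₁ (t₂.arrow (.var (.poly α))) Ps →
      Rule ⟨.plain, Γ, .atom (.app x₁ x₂), .infer⟩ [] (.subst Ps .typ .untyp)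
  | caseVar {Γ x τ x₁ x₂} : Var.bnd x ∉ Γ →
      Rule ⟨.plain, Γ, .atom (.tcase x τ x₁ x₂), .infer⟩ [] (.var x .infer .untyp)
  | caseSplit {Γ x τ x₁ x₂ t} : Γ.lookup (.bnd x) = some t →
      ¬ t.Sub τ.toTy → ¬ t.Sub τ.toTy.neg →
      Rule ⟨.plain, Γ, .atom (.tcase x τ x₁ x₂), .infer⟩ []
        (.part (Finmap.singleton (.bnd x) τ.toTy) .infer .infer)
  | caseEmpty {Γ x τ x₁ x₂ t} : Γ.lookup (.bnd x) = some t → t.Equiv .empty →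
      Rule ⟨.plain, Γ, .atom (.tcase x τ x₁ x₂), .infer⟩ [] (.ok .typ)
  | caseThen {Γ x τ x₁ x₂ t Ps} : Γ.lookup (.bnd x) = some t → ¬ t.Equiv .empty →
      t.Sub τ.toTy → IsTallyInfer Γ.vars t .empty Ps →
      Rule ⟨.plain, Γ, .atom (.tcase x τ x₁ x₂), .infer⟩ [] (.subst Ps .typ .then_)
  | caseElse {Γ x τ x₁ x₂ t Ps} : Γ.lookup (.bnd x) = some t → ¬ t.Equiv .empty →
      t.Sub τ.toTy.neg → IsTallyInfer Γ.vars t .empty Ps →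
      Rule ⟨.plain, Γ, .atom (.tcase x τ x₁ x₂), .infer⟩ [] (.subst Ps .typ .else_)
  | caseVar₁ {Γ x τ x₁ x₂} : Var.bnd x₁ ∉ Γ →
      Rule ⟨.plain, Γ, .atom (.tcase x τ x₁ x₂), .then_⟩ [] (.var x₁ .typ .untyp)
  | caseVar₂ {Γ x τ x₁ x₂} : Var.bnd x₂ ∉ Γ →
      Rule ⟨.plain, Γ, .atom (.tcase x τ x₁ x₂), .else_⟩ [] (.var x₂ .typ .untyp)
  | caseOk₁ {Γ x τ x₁ x₂} : Var.bnd x₁ ∈ Γ →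
      Rule ⟨.plain, Γ, .atom (.tcase x τ x₁ x₂), .then_⟩ [] (.ok .typ)
  | caseOk₂ {Γ x τ x₁ x₂} : Var.bnd x₂ ∈ Γ →
      Rule ⟨.plain, Γ, .atom (.tcase x τ x₁ x₂), .else_⟩ [] (.ok .typ)
  | lamInfer {Γ x κ α r} : .mono α ∉ Γ.vars →
      Rule ⟨.plain, Γ, .atom (.lam x κ), .infer⟩
        [(⟨.plain, Γ, .atom (.lam x κ), .lam (.var (.mono α)) .infer⟩, r)] r
  | lamEmpty {Γ x κ B} : Rule ⟨.plain, Γ, .atom (.lam x κ), .lam .empty B⟩ [] .fail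
  | lam {Γ x κ t B r} : t ≠ .empty →
      Rule ⟨.plain, Γ, .atom (.lam x κ), .lam t B⟩
        [(⟨.iter, Γ.insert (.lam x) t, .form κ, B⟩, r)] (r.map fun X => .lam t X)
  | formVar {Γ x} : Var.bnd x ∉ Γ →
      Rule ⟨.plain, Γ, .form (.bvar x), .infer⟩ [] (.var x .infer .untyp)
  | formOk {Γ x} : Var.bnd x ∈ Γ → Rule ⟨.plain, Γ, .form (.bvar x), .infer⟩ [] (.ok .typ)
  | bindInfer {Γ x a κ r} :
      Rule ⟨.plain, Γ, .form (.bind x a κ), .infer⟩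
        [(⟨.plain, Γ, .form (.bind x a κ), .trySkip .infer⟩, r)] r
  | bindTrySkip₁ {Γ x a κ B B₁ B₂ r} :
      Rule ⟨.plain, Γ, .form (.bind x a κ), .trySkip B⟩
        [(⟨.iter, Γ, .form κ, B⟩, .var x B₁ B₂),
          (⟨.plain, Γ, .form (.bind x a κ), .tryKeep .infer B₁ B₂⟩, r)] r
  | bindTrySkip₂ {Γ x a κ B B'} :
      Rule ⟨.plain, Γ, .form (.bind x a κ), .trySkip B⟩
        [(⟨.iter, Γ, .form κ, B⟩, .ok B')] (.ok (.skip B'))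
  | bindTrySkip₃ {Γ x a κ B r} : (∀ B₁ B₂, r ≠ .var x B₁ B₂) → (∀ B', r ≠ .ok B') →
      Rule ⟨.plain, Γ, .form (.bind x a κ), .trySkip B⟩
        [(⟨.iter, Γ, .form κ, B⟩, r)] (r.map fun X => .trySkip X)
  | bindSkip₁ {Γ x a κ B B₁ B₂ r} :
      Rule ⟨.plain, Γ, .form (.bind x a κ), .skip B⟩
        [(⟨.iter, Γ, .form κ, B⟩, .var x B₁ B₂),
          (⟨.plain, Γ, .form (.bind x a κ), .skip B₂⟩, r)] r
  | bindSkip₂ {Γ x a κ B r} : (∀ B₁ B₂, r ≠ .var x B₁ B₂) →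
      Rule ⟨.plain, Γ, .form (.bind x a κ), .skip B⟩
        [(⟨.iter, Γ, .form κ, B⟩, r)] (r.map fun X => .skip X)
  | bindTryKeep₁ {Γ x a κ A A' B₁ B₂ r} :
      Rule ⟨.plain, Γ, .form (.bind x a κ), .tryKeep A B₁ B₂⟩
        [(⟨.iter, Γ, .atom a, A⟩, .ok A'),
          (⟨.plain, Γ, .form (.bind x a κ), .keep A' [(.any, B₁)] []⟩, r)] r
  | bindTryKeep₂ {Γ x a κ A B₁ B₂ r} :
      Rule ⟨.plain, Γ, .form (.bind x a κ), .tryKeep A B₁ B₂⟩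
        [(⟨.iter, Γ, .atom a, A⟩, .fail),
          (⟨.plain, Γ, .form (.bind x a κ), .skip B₂⟩, r)] r
  | bindTryKeep₃ {Γ x a κ A B₁ B₂ r} : (∀ A', r ≠ .ok A') → r ≠ .fail →
      Rule ⟨.plain, Γ, .form (.bind x a κ), .tryKeep A B₁ B₂⟩
        [(⟨.iter, Γ, .atom a, A⟩, r)] (r.map fun X => .tryKeep X B₁ B₂)
  | bindOk {Γ x a κ A S₂} :
      Rule ⟨.plain, Γ, .form (.bind x a κ), .keep A [] S₂⟩ [] (.ok (.keep A [] S₂))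
  | bindKeep₁ {Γ x a κ A S₁ S₂ t B aa s B' r} : (t, B) ∈ S₁ →
      Aux Γ (.atom a) A aa → HasTy Γ (.atom a) aa s →
      Rule ⟨.plain, Γ, .form (.bind x a κ), .keep A S₁ S₂⟩
        [(⟨.iter, Γ.insert (.bnd x) (s.and t), .form κ, B⟩, .ok B'),
          (⟨.plain, Γ, .form (.bind x a κ),
            .keep A (Ann.removeSplit S₁ (t, B)) ((t, B') :: S₂)⟩, r)] r
  | bindKeep₂ {Γ x a κ A S₁ S₂ t B aa s G B₁ B₂ u Gs₁ Gs₂} : (t, B) ∈ S₁ →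
      Aux Γ (.atom a) A aa → HasTy Γ (.atom a) aa s →
      G.lookup (.bnd x) = some u →
      Split Γ a (t.and u).neg Gs₁ → Split Γ a (t.diff u).neg Gs₂ →
      Rule ⟨.plain, Γ, .form (.bind x a κ), .keep A S₁ S₂⟩
        [(⟨.iter, Γ.insert (.bnd x) (s.and t), .form κ, B⟩, .part G B₁ B₂)]
        (.part (G.erase (.bnd x))
          (.prop A (Gs₁ ++ Gs₂)
            ((t.and u, B₁) :: (t.diff u, B₂) :: Ann.removeSplit S₁ (t, B)) S₂)
          (.keep A ((t, B₂) :: Ann.removeSplit S₁ (t, B)) S₂))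
  | bindKeep₃ {Γ x a κ A S₁ S₂ t B aa s r} : (t, B) ∈ S₁ →
      Aux Γ (.atom a) A aa → HasTy Γ (.atom a) aa s →
      (∀ B', r ≠ .ok B') → (∀ G B₁ B₂, r = .part G B₁ B₂ → Var.bnd x ∉ G) →
      Rule ⟨.plain, Γ, .form (.bind x a κ), .keep A S₁ S₂⟩
        [(⟨.iter, Γ.insert (.bnd x) (s.and t), .form κ, B⟩, r)]
        (r.map fun X => .keep A ((t, X) :: Ann.removeSplit S₁ (t, B)) S₂)
  | bindProp₁ {Γ x a κ A Gs S₁ S₂ G} : G ∈ Gs → Compatible Γ G →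
      Rule ⟨.plain, Γ, .form (.bind x a κ), .prop A Gs S₁ S₂⟩ []
        (.part (Env.filter G fun y t => ∀ s, Γ.lookup y = some s → ¬ s.Sub t)
          (.keep A S₁ S₂) (.prop A (Ann.removeEnv Gs G) S₁ S₂))
  | bindProp₂ {Γ x a κ A Gs S₁ S₂ r} : (∀ G ∈ Gs, ¬ Compatible Γ G) →
      Rule ⟨.plain, Γ, .form (.bind x a κ), .prop A Gs S₁ S₂⟩
        [(⟨.plain, Γ, .form (.bind x a κ), .keep A S₁ S₂⟩, r)] r
  | interEmpty {Γ η} : Rule ⟨.plain, Γ, η, .inter [] []⟩ [] .fail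
  | interOk {Γ η S₂} : S₂ ≠ [] → Rule ⟨.plain, Γ, η, .inter [] S₂⟩ [] (.ok (.inter [] S₂))
  | inter₁ {Γ η A S₁ S₂ A' r} : A ∈ S₁ →
      Rule ⟨.plain, Γ, η, .inter S₁ S₂⟩
        [(⟨.iter, Γ, η, A⟩, .ok A'),
          (⟨.plain, Γ, η, .inter (Ann.remove S₁ A) (A' :: S₂)⟩, r)] r
  | inter₂ {Γ η A S₁ S₂ r} : A ∈ S₁ →
      Rule ⟨.plain, Γ, η, .inter S₁ S₂⟩
        [(⟨.iter, Γ, η, A⟩, .fail), (⟨.plain, Γ, η, .inter (Ann.remove S₁ A) S₂⟩, r)] r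
  | inter₃ {Γ η A S₁ S₂ r} : A ∈ S₁ → (∀ A', r ≠ .ok A') → r ≠ .fail →
      Rule ⟨.plain, Γ, η, .inter S₁ S₂⟩
        [(⟨.iter, Γ, η, A⟩, r)] (r.map fun X => .inter (X :: Ann.remove S₁ A) S₂)
  | iterate₁ {Γ η A A₁ A₂ r} :
      Rule ⟨.iter, Γ, η, A⟩
        [(⟨.plain, Γ, η, A⟩, .part ∅ A₁ A₂), (⟨.iter, Γ, η, A₁⟩, r)] r
  | iterate₂ {Γ η A Ps A₁ A₂ r} : (∀ ψ ∈ Ps, Subst.Disj ψ Γ) →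
      Rule ⟨.iter, Γ, η, A⟩
        [(⟨.plain, Γ, η, A⟩, .subst Ps A₁ A₂),
          (⟨.iter, Γ, η, .inter (Ps.map (fun ψ => A₁.subst ψ) ++ [A₂]) []⟩, r)] r
  | iterStop {Γ η A r} : ¬ r.Iterable Γ →
      Rule ⟨.iter, Γ, η, A⟩ [(⟨.plain, Γ, η, A⟩, r)] r

/-- Derivability of the two main judgments. -/
inductive Derives : Call S → Res S → Prop
  | mk {c ps r} : Rule c ps r → (∀ p ∈ ps, Derives p.1 p.2) → Derives c r

/-! ### The algorithm -/

/-- A judgment under evaluation: its input, and the premises evaluated so far with their results. -/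
structure Frame (S : Sig) where
  call : Call S
  done : List (Call S × Res S)

/-- A state of the algorithm: either a stack of judgments under evaluation (the current one, and
those that wait for its result), or a final result. -/
inductive State (S : Sig) where
  | run (top : Frame S) (stack : List (Frame S))
  | final (r : Res S)

def State.init (c : Call S) : State S := .run ⟨c, []⟩ []

/-- One step of the algorithm: it starts the evaluation of the next premise of a rule that agrees
with the premises evaluated so far, or all premises of a rule have been evaluated, and its result is
returned. -/
inductive Step : State S → State S → Prop
  | call {c ps c' r' qs r K} : Rule c (ps ++ (c', r') :: qs) r →
      Step (.run ⟨c, ps⟩ K) (.run ⟨c', []⟩ (⟨c, ps⟩ :: K))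
  | ret {c ps r c' ps' K} : Rule c ps r →
      Step (.run ⟨c, ps⟩ (⟨c', ps'⟩ :: K)) (.run ⟨c', ps' ++ [(c, r)]⟩ K)
  | halt {c ps r} : Rule c ps r → Step (.run ⟨c, ps⟩ []) (.final r)

/-- The algorithm has failed: no rule applies to the current judgment, given the results of the
premises evaluated so far. -/
def State.Failed : State S → Prop
  | .run f _ => ¬ ∃ qs r, Rule f.call (f.done ++ qs) r
  | .final _ => False

end

end Recon

namespace Recon

variable {S : Sig}

/-! ### The algorithm and derivability -/

-- Parts (2) and (3) are bookkeeping on stacks: a run builds a derivation premise by premise, and a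
-- derivation can be replayed as a run (`derives_of_run`, `run_of_derives`, `failed_or_final`). For
-- (1), rules have boundedly many premises, so an infinite run would need an infinite chain of
-- nested calls. It thus suffices that `Calls` is well-founded (`acc_run`, `acc_calls`).
--
-- A call that is not on a smaller expression is on the same expression in the same environment. It
-- either has another annotation, often taken from the result of an earlier premise, or is the plain
-- version of an iterated judgment. Annotations therefore get weights, and the crux is
-- `Derives.lowers`: the annotations in a `part`, `subst` or `var` result are lighter than the input
-- annotation, in the sense of `Res.Lowers`. Calls then descend lexicographically in the size of the
-- expression, the weight of the annotation, and the mode (`Rule.descends`, `acc_calls_of_weight`).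
--
-- Three obstacles shape the weight. (a) A result may contain the very annotation `infer` that was
-- given; progress lies in the assumption that comes with it, that a variable is present or a test
-- is settled. So weights depend on a `Know`, the abstract information about the environment, and
-- decrease as it grows. (b) One annotation may be replaced by any finite number of lighter ones. So
-- weights are finite multisets of ordinals in the Dershowitz–Manna order, and every annotation
-- other than an intersection has a one-element weight `pow o`, below which sums remain; weights of
-- components become exponents through `rank`. Intersections are plain sums, which is harmless
-- because they never return a result that is iterated (`Derives.not_iterable`). (c) When the body
-- of a definition asks for its variable, inference on the defining atom starts and the body gets
-- two annotations. `bodyWeight v w` exceeds both the cost `v` of that inference and all finite sums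
-- of contributions of bodies lighter than `w`.

/-- The algorithm can evaluate `c'` as a premise of `c`. -/
def Calls (c' c : Call S) : Prop :=
  ∃ ps r' qs r, Rule c (ps ++ (c', r') :: qs) r ∧ ∀ p ∈ ps, Derives p.1 p.2

/-- The bound gives a measure, the number of premises left, for the time that a judgment stays on
the stack. -/
theorem Rule.length_le {c : Call S} {ps : List (Call S × Res S)} {r : Res S} (h : Rule c ps r) :
    ps.length ≤ 2 := by
  cases h <;> simp

/-- A state in which the premises evaluated so far are derivable. -/
def State.Sound : State S → Prop
  | .run f K => ∀ g ∈ f :: K, ∀ p ∈ g.done, Derives p.1 p.2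
  | .final _ => True

theorem Step.sound {s s' : State S} (h : Step s s') (hs : s.Sound) : s'.Sound := by
  cases h with
  | call h =>
    intro g hg
    rcases List.mem_cons.1 hg with rfl | hg
    · simp
    · exact hs g hg
  | @ret c ps r c' ps' K h =>
    intro g hg p hp
    rcases List.mem_cons.1 hg with rfl | hg
    · rcases List.mem_append.1 hp with hp | hp
      · exact hs ⟨c', ps'⟩ (by simp) p hp
      · obtain rfl : p = (c, r) := by simpa using hp
        exact .mk h (hs ⟨c, ps⟩ (by simp))
    · exact hs g (by simp [hg]) p hp
  | halt h => trivial

/-- The judgment at the bottom of the stack has input `c`, or the final result is derivable for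
`c`. -/
def State.root (c : Call S) : State S → Prop
  | .run f K => ∃ g, (f :: K).getLast? = some g ∧ g.call = c
  | .final r => Derives c r

theorem Step.root {c : Call S} {s s' : State S} (h : Step s s') (hs : s.Sound) (hr : s.root c) :
    s'.root c := by
  cases h with
  | call h =>
    obtain ⟨g, hg, hc⟩ := hr
    exact ⟨g, by rw [List.getLast?_cons_cons]; exact hg, hc⟩
  | @ret c₁ ps r c' ps' K h =>
    obtain ⟨g, hg, hc⟩ := hr
    rw [List.getLast?_cons_cons] at hg
    cases K with
    | nil =>
      obtain rfl : ⟨c', ps'⟩ = g := by simpa using hg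
      exact ⟨_, rfl, hc⟩
    | cons f K =>
      rw [List.getLast?_cons_cons] at hg
      exact ⟨g, by rw [List.getLast?_cons_cons]; exact hg, hc⟩
  | @halt c₁ ps r h =>
    obtain ⟨g, hg, hc⟩ := hr
    obtain rfl : ⟨c₁, ps⟩ = g := by simpa using hg
    subst hc
    exact .mk h (hs ⟨c₁, ps⟩ (by simp))

theorem State.sound_init (c : Call S) : (State.init c).Sound := by
  simp [State.init, State.Sound]

theorem derives_of_run {c : Call S} {r : Res S}
    (h : Relation.ReflTransGen Step (State.init c) (.final r)) : Derives c r := by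
  have key : ∀ s, Relation.ReflTransGen Step (State.init c) s → s.Sound ∧ s.root c := by
    intro s hs
    induction hs with
    | refl => exact ⟨State.sound_init c, ⟨⟨c, []⟩, rfl, rfl⟩⟩
    | tail _ h ih => exact ⟨h.sound ih.1, h.root ih.1 ih.2⟩
  exact (key _ h).2

/-- The stack below is arbitrary so that the statement applies to premises, and the run stops before
returning, so that the caller can choose between `Step.ret` and `Step.halt`. -/
theorem Derives.run {c : Call S} {r : Res S} (h : Derives c r) :
    ∃ ps, Rule c ps r ∧ ∀ K, Relation.ReflTransGen Step (.run ⟨c, []⟩ K) (.run ⟨c, ps⟩ K) := by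
  induction h with
  | @mk c ps r h _ ih =>
    refine ⟨ps, h, fun K => ?_⟩
    have key : ∀ qs ps', ps' ++ qs = ps →
        Relation.ReflTransGen Step (.run ⟨c, ps'⟩ K) (.run ⟨c, ps⟩ K) := by
      intro qs
      induction qs with
      | nil =>
        rintro ps' rfl
        simp only [List.append_nil]
        exact .refl
      | cons q qs ihq =>
        intro ps' hps
        obtain ⟨ps₁, h₁, hrun⟩ := ih q (by simp [← hps])
        refine .trans (.head (.call (c' := q.1) (r' := q.2) (qs := qs) (r := r) ?_)
          ((hrun _).tail (.ret h₁))) (ihq _ ?_)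
        · rw [hps]; exact h
        · simpa using hps
    exact key ps [] rfl

theorem run_of_derives {c : Call S} {r : Res S} (h : Derives c r) :
    Relation.ReflTransGen Step (State.init c) (.final r) := by
  obtain ⟨ps, h, hrun⟩ := h.run
  exact (hrun []).tail (.halt h)

theorem failed_or_final {s : State S} (h : ∀ s', ¬ Step s s') :
    s.Failed ∨ ∃ r, s = .final r := by
  cases s with
  | final r => exact .inr ⟨r, rfl⟩
  | run f K =>
    refine .inl ?_
    rintro ⟨qs, r, hr⟩
    cases qs with
    | cons q qs => exact h _ (.call (c := f.call) (ps := f.done) hr)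
    | nil =>
      rw [List.append_nil] at hr
      cases K with
      | nil => exact h _ (.halt (c := f.call) hr)
      | cons g K => exact h _ (.ret (c := f.call) (c' := g.call) (ps' := g.done) hr)

/-- Accessibility of a call is turned into accessibility of machine states. The hypothesis on `K`
plays the role of a continuation: whatever happens once `c` has returned is already known to
terminate. The condition `s ≠ .run f (⟨c, ps⟩ :: K)` excludes the steps that push a premise, which
are dealt with here. -/
theorem acc_run {c : Call S} (hc : Acc Calls c) : ∀ K : List (Frame S),
    (∀ ps r, Rule c ps r → (∀ p ∈ ps, Derives p.1 p.2) →
      ∀ s, Step (.run ⟨c, ps⟩ K) s → (∀ f, s ≠ .run f (⟨c, ps⟩ :: K)) → Acc (flip Step) s) →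
    ∀ ps : List (Call S × Res S), (∀ p ∈ ps, Derives p.1 p.2) →
      Acc (flip Step) (.run ⟨c, ps⟩ K) := by
  induction hc with
  | intro c _ ih =>
    intro K hK ps
    -- Inner induction for the judgment `c` itself, on the number of premises that can still be
    -- evaluated.
    induction hn : 2 - ps.length using Nat.strong_induction_on generalizing ps with
    | _ n ihn =>
      intro hps
      refine .intro _ fun s hs => ?_
      have hs' : Step (.run ⟨c, ps⟩ K) s := hs
      cases hs' with
      | @call _ _ c' r' qs r _ h =>
        -- The pushed premise terminates by the outer induction; its continuation is the frame of
        -- `c` with one more evaluated premise.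
        refine ih c' ⟨ps, r', qs, r, h, hps⟩ _ ?_ [] (by simp)
        intro ps₁ r₁ h₁ hd₁ s₁ hs₁ hne
        cases hs₁ with
        | call h => exact absurd rfl (hne _)
        -- The result `r₂` need not be the `r'` of the rule instance that prompted the call; only
        -- its derivability matters.
        | @ret _ _ r₂ _ _ _ h₂ =>
          refine ihn _ ?_ (ps ++ [(c', r₂)]) rfl ?_
          · have := h.length_le
            simp only [List.length_append, List.length_cons, List.length_nil] at this ⊢
            omega
          · intro p hp
            rcases List.mem_append.1 hp with hp | hp
            · exact hps p hp
            · obtain rfl : p = (c', r₂) := by simpa using hp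
              exact .mk h₂ hd₁
      | ret h => exact hK ps _ h hps _ hs (fun f hf => by
          injection hf with _ hf
          have := congrArg List.length hf
          simp at this
          omega)
      | halt h => exact hK ps _ h hps _ hs (fun f hf => by cases hf)

theorem not_infinite_run {c : Call S} (hc : Acc Calls c) :
    ¬ ∃ f : ℕ → State S, f 0 = State.init c ∧ ∀ n, Step (f n) (f (n + 1)) := by
  rintro ⟨f, h0, hf⟩
  have hacc : Acc (flip Step) (State.init c) := by
    refine acc_run hc [] ?_ [] (by simp)
    intro ps r _ _ s hs hne
    cases hs with
    | call h => exact absurd rfl (hne _)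
    | @halt _ _ r h =>
      refine .intro _ fun s hs => ?_
      have hs' : Step (.final r) s := hs
      cases hs'
  have key : ∀ s : State S, Acc (flip Step) s → ∀ n, f n ≠ s := by
    intro s hs
    induction hs with
    | intro s _ ih =>
      rintro n rfl
      exact ih _ (hf n) (n + 1) rfl
  exact key _ hacc 0 h0

/-! ### Weights -/

/-- Finite multisets of ordinals, with the Dershowitz–Manna order. -/
def Weight : Type 1 := Multiset Ordinal.{0}

namespace Weight

def toMultiset (w : Weight) : Multiset Ordinal.{0} := w

noncomputable instance : AddCommMonoid Weight := inferInstanceAs (AddCommMonoid (Multiset Ordinal))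

theorem wf_dm : WellFounded fun v w : Weight => Multiset.IsDershowitzMannaLT v w :=
  Multiset.wellFounded_isDershowitzMannaLT

instance : PartialOrder Weight where
  le v w := v = w ∨ Multiset.IsDershowitzMannaLT v w
  lt v w := Multiset.IsDershowitzMannaLT v w
  le_refl v := .inl rfl
  le_trans := by
    rintro u v w (rfl | h) (rfl | h')
    · exact .inl rfl
    · exact .inr h'
    · exact .inr h
    · exact .inr (h.trans h')
  lt_iff_le_not_ge v w := by
    constructor
    · refine fun h => ⟨.inr h, ?_⟩
      rintro (rfl | h')
      · exact wf_dm.irrefl.irrefl _ h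
      · exact wf_dm.irrefl.irrefl _ (h.trans h')
    · rintro ⟨rfl | h, h'⟩
      · exact absurd (.inl rfl) h'
      · exact h
  le_antisymm := by
    rintro v w (rfl | h) (h' | h')
    · rfl
    · rfl
    · exact h'.symm
    · exact absurd (h.trans h') (wf_dm.irrefl.irrefl _)

theorem wf_lt : WellFounded fun v w : Weight => v < w := wf_dm

instance : WellFoundedRelation Weight := ⟨fun v w => v < w, wf_lt⟩

/-- The added multiset joins the part common to both sides. -/
instance : AddLeftStrictMono Weight where
  elim u v w h := by
    obtain ⟨X, Y, Z, hZ, rfl, rfl, hYZ⟩ := h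
    exact ⟨u.toMultiset + X, Y, Z, hZ, (add_assoc u.toMultiset X Y).symm,
      (add_assoc u.toMultiset X Z).symm, hYZ⟩

instance : IsOrderedAddMonoid Weight where
  add_le_add_left v w h u := by
    rcases h.eq_or_lt with rfl | h
    · exact le_rfl
    · rw [add_comm v, add_comm w]
      exact (add_lt_add_right h u).le

/-- The weight with the single element `o`. -/
def pow (o : Ordinal.{0}) : Weight := ({o} : Multiset Ordinal)

/-- A one-element multiset can only be lowered by replacing its element with any number of smaller
ones. This makes `pow o` behave like an additively indecomposable ordinal. -/
theorem lt_pow {w : Weight} {o : Ordinal.{0}} : w < pow o ↔ ∀ e ∈ w.toMultiset, e < o := by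
  constructor
  · rintro ⟨X, Y, Z, hZ, rfl, h, hYZ⟩
    have h' : X + Z = {o} := h.symm
    obtain ⟨z, hz⟩ := Multiset.exists_mem_of_ne_zero hZ
    obtain ⟨Z, rfl⟩ := Multiset.exists_cons_of_mem hz
    obtain ⟨rfl, rfl, rfl⟩ : z = o ∧ X = 0 ∧ Z = 0 := by
      have hc := congrArg Multiset.card h'
      simp only [Multiset.card_add, Multiset.card_cons, Multiset.card_singleton] at hc
      obtain rfl := Multiset.card_eq_zero.1 (show X.card = 0 by omega)
      obtain rfl := Multiset.card_eq_zero.1 (show Z.card = 0 by omega)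
      simpa using h'
    intro e he
    obtain ⟨z', hz', hez⟩ := hYZ e (by simpa [toMultiset] using he)
    rw [Multiset.mem_cons, or_iff_left (Multiset.notMem_zero _)] at hz'
    exact hz' ▸ hez
  · intro h
    exact ⟨0, w.toMultiset, {o}, by simp, (zero_add _).symm, (zero_add _).symm,
      fun y hy => ⟨o, by simp, h y hy⟩⟩

theorem zero_lt {w : Weight} (h : w ≠ 0) : 0 < w :=
  ⟨0, 0, w, h, (zero_add _).symm, (zero_add _).symm, fun _ h => absurd h (Multiset.notMem_zero _)⟩

theorem zero_le (w : Weight) : 0 ≤ w := by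
  by_cases h : w = 0
  · exact h.ge
  · exact (zero_lt h).le

theorem pow_pos (o : Ordinal.{0}) : 0 < pow o :=
  lt_pow.2 fun _ h => absurd h (Multiset.notMem_zero _)

theorem pow_lt_pow {o o' : Ordinal.{0}} (h : o < o') : pow o < pow o' :=
  lt_pow.2 fun e he => by
    obtain rfl : e = o := Multiset.mem_singleton.1 he
    exact h

theorem pow_le_pow {o o' : Ordinal.{0}} (h : o ≤ o') : pow o ≤ pow o' := by
  rcases h.eq_or_lt with rfl | h
  · exact le_rfl
  · exact (pow_lt_pow h).le

theorem add_lt_pow {v w : Weight} {o : Ordinal.{0}} (hv : v < pow o) (hw : w < pow o) :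
    v + w < pow o := by
  rw [lt_pow] at *
  intro e he
  rcases Multiset.mem_add.1 he with he | he
  exacts [hv e he, hw e he]

theorem sum_lt_pow {l : List Weight} {o : Ordinal.{0}} (h : ∀ w ∈ l, w < pow o) :
    l.sum < pow o := by
  induction l with
  | nil => exact pow_pos o
  | cons w l ih =>
    rw [List.sum_cons]
    exact add_lt_pow (h w (by simp)) (ih fun w hw => h w (by simp [hw]))

theorem nsmul_lt_pow {v : Weight} {o : Ordinal.{0}} (h : v < pow o) (n : ℕ) : n • v < pow o := by
  induction n with
  | zero => rw [zero_nsmul]; exact pow_pos o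
  | succ n ih => rw [succ_nsmul]; exact add_lt_pow ih h

/-- `Weight` lives in `Type 1`. Smallness of its initial segments is what makes `rank` an ordinal of
universe 0, so that ranks can again be elements of weights. -/
instance small_Iio (w : Weight) : Small.{0} {v : Weight // v < w} := by
  classical
  let f : List (Set.Iic (w.toMultiset.sup)) → Multiset Ordinal.{0} :=
    fun l => (l.map Subtype.val : List Ordinal)
  have : Small.{0} (Set.range f) := small_range f
  refine small_of_injective (β := Set.range f) (f := fun v => ⟨v.1, ?_⟩) ?_
  · obtain ⟨v, hv⟩ := v
    -- Everything below `w` is made of ordinals up to the supremum of `w`, hence is the image of a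
    -- list over a small set.
    have hle : ∀ e ∈ v.toMultiset, e ≤ w.toMultiset.sup := by
      obtain ⟨X, Y, Z, -, rfl, rfl, hYZ⟩ := hv
      intro e he
      rcases Multiset.mem_add.1 he with he | he
      · exact Multiset.le_sup (Multiset.mem_add.2 (.inl he))
      · obtain ⟨z, hz, hez⟩ := hYZ e he
        exact hez.le.trans (Multiset.le_sup (Multiset.mem_add.2 (.inr hz)))
    obtain ⟨l, hl⟩ := Quot.exists_rep v.toMultiset
    have hl' : (l : Multiset Ordinal) = v := hl
    refine ⟨l.attach.map fun e => ⟨e.1, hle e.1 (by rw [← hl']; exact e.2)⟩, ?_⟩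
    simp only [f, List.map_map, Function.comp_def, List.attach_map_subtype_val]
    exact hl'
  · intro v v' h
    exact Subtype.ext (show v.1 = v'.1 from congrArg (fun z : Set.range f => z.1) h)

/-- The rank of a weight in the order of weights. -/
noncomputable def rank (w : Weight) : Ordinal.{0} :=
  ⨆ v : {v : Weight // v < w}, Order.succ (rank v.1)
termination_by w
decreasing_by exact v.2

theorem rank_lt_rank {v w : Weight} (h : v < w) : rank v < rank w := by
  rw [rank.eq_1 w]
  exact (Order.lt_succ _).trans_le
    (Ordinal.le_iSup (fun v : {v : Weight // v < w} => Order.succ (rank v.1)) ⟨v, h⟩)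

theorem rank_le_rank {v w : Weight} (h : v ≤ w) : rank v ≤ rank w := by
  rcases h.eq_or_lt with rfl | h
  · exact le_rfl
  · exact (rank_lt_rank h).le

theorem lt_pow_rank_add_one (w : Weight) : w < pow (rank w + 1) := by
  refine lt_pow.2 fun e he => Order.lt_add_one_iff.2 ?_
  -- A strictly increasing map from ordinals to ordinals lies above the identity.
  have h₁ : e ≤ rank (pow e) :=
    StrictMono.le_apply (f := fun e => rank (pow e)) fun a b h => rank_lt_rank (pow_lt_pow h)
  refine h₁.trans (rank_le_rank ?_)
  obtain ⟨u, hu⟩ : ∃ u : Weight, w = pow e + u := by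
    obtain ⟨u, hu⟩ := Multiset.exists_cons_of_mem he
    exact ⟨u, hu.trans (Multiset.singleton_add _ _).symm⟩
  rw [hu]
  exact le_add_of_nonneg_right (zero_le u)

end Weight

/-! ### Tests settled by a type -/

namespace Ty

/-- One unfolding of the corecursion: at a label other than a variable, the step function keeps the
label and goes on in the children. -/
theorem subst_node {l : Label S} (hl : ∀ α, l ≠ .var α) (f : Fin l.arity → Ty S) (σ : Subst S) :
    (node l f).subst σ = node l fun i => (f i).subst σ := by
  apply Subtype.ext
  change Tree.substFrom (fun α => (σ α).1) (.inl (PFunctor.M.mk ⟨l, fun i => (f i).1⟩)) =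
    PFunctor.M.mk _
  rw [← PFunctor.M.mk_dest (Tree.substFrom _ _), Tree.dest_substFrom]
  congr 1
  -- The unfolded node is a variable `x` here because the type of its children depends on its label,
  -- which obstructs rewriting.
  have hs : ∀ (u : Tree S) (x : (treeF S) (Tree S)), u.dest = x → (∀ α, x.1 ≠ .var α) →
      Tree.substStep (fun α => (σ α).1) (.inl u) = (treeF S).map Sum.inl x := by
    rintro u _ rfl hu
    cases h : u.dest.1 with
    | var α => exact absurd h (hu α)
    | _ => simp only [Tree.substStep, Tree.label, h]
  exact congrArg _ (hs _ _ (PFunctor.M.dest_mk _) hl)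

theorem subst_base (b : S.Base) (σ : Subst S) : (base b).subst σ = base b :=
  (subst_node (by simp) _ σ).trans (congrArg (node _) (funext fun i : Fin 0 => i.elim0))

theorem subst_empty (σ : Subst S) : (empty : Ty S).subst σ = empty :=
  (subst_node (by simp) _ σ).trans (congrArg (node _) (funext fun i : Fin 0 => i.elim0))

theorem subst_neg (t : Ty S) (σ : Subst S) : (neg t).subst σ = neg (t.subst σ) :=
  subst_node (by simp) _ σ

theorem subst_or (t s : Ty S) (σ : Subst S) : (or t s).subst σ = or (t.subst σ) (s.subst σ) :=
  (subst_node (by simp) _ σ).trans (congrArg (node _) (funext fun i : Fin 2 =>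
    apply_ite (fun u : Ty S => u.subst σ) (i = 0) t s))

theorem subst_prod (t s : Ty S) (σ : Subst S) :
    (prod t s).subst σ = prod (t.subst σ) (s.subst σ) :=
  (subst_node (by simp) _ σ).trans (congrArg (node _) (funext fun i : Fin 2 =>
    apply_ite (fun u : Ty S => u.subst σ) (i = 0) t s))

theorem subst_arrow (t s : Ty S) (σ : Subst S) :
    (arrow t s).subst σ = arrow (t.subst σ) (s.subst σ) :=
  (subst_node (by simp) _ σ).trans (congrArg (node _) (funext fun i : Fin 2 =>
    apply_ite (fun u : Ty S => u.subst σ) (i = 0) t s))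

theorem subst_and (t s : Ty S) (σ : Subst S) :
    (and t s).subst σ = and (t.subst σ) (s.subst σ) := by
  simp only [and, subst_neg, subst_or]

/-- Test types contain no type variable; for this reason a substitution cannot reopen a settled
test. -/
theorem subst_toTy (τ : TestTy S) (σ : Subst S) : τ.toTy.subst σ = τ.toTy := by
  induction τ with
  | base b => exact subst_base b σ
  | fn => simp only [TestTy.toTy, any, subst_arrow, subst_neg, subst_empty]
  | prod τ τ' ih ih' => simp only [TestTy.toTy, subst_prod, ih, ih']
  | or τ τ' ih ih' => simp only [TestTy.toTy, subst_or, ih, ih']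
  | neg τ ih => simp only [TestTy.toTy, subst_neg, ih]
  | empty => exact subst_empty σ

theorem view_neg (t : Ty S) : (neg t).view = .neg t := by
  have hd : (neg t).1.dest = ⟨.neg, fun _ => t.1⟩ := PFunctor.M.dest_mk _
  have hl : (neg t).1.label = .neg := congrArg Sigma.fst hd
  have hc : ∀ x : (treeF S) (Tree S), x = ⟨.neg, fun _ => t.1⟩ → ∀ i, x.2 i = t.1 := by
    rintro _ rfl i
    rfl
  unfold view
  split
  case h_6 => exact congrArg View.neg (Subtype.ext (hc _ hd _))
  all_goals
    rename_i h
    rw [hl] at h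
    cases h

theorem view_or (t s : Ty S) : (or t s).view = .or t s := by
  have hd : (or t s).1.dest = ⟨.or, fun i : Fin 2 => (if i = 0 then t else s).1⟩ :=
    PFunctor.M.dest_mk _
  have hl : (or t s).1.label = .or := congrArg Sigma.fst hd
  have hc₀ : ∀ x : (treeF S) (Tree S), x = ⟨.or, fun i : Fin 2 => (if i = 0 then t else s).1⟩ →
      ∀ h : 2 = x.1.arity, x.2 (Fin.cast h 0) = t.1 := by
    rintro _ rfl h
    rfl
  have hc₁ : ∀ x : (treeF S) (Tree S), x = ⟨.or, fun i : Fin 2 => (if i = 0 then t else s).1⟩ →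
      ∀ h : 2 = x.1.arity, x.2 (Fin.cast h 1) = s.1 := by
    rintro _ rfl h
    rfl
  unfold view
  split
  case h_5 => exact congrArg₂ View.or (Subtype.ext (hc₀ _ hd _)) (Subtype.ext (hc₁ _ hd _))
  all_goals
    rename_i h
    rw [hl] at h
    cases h

end Ty

-- Membership in Boolean combinations

theorem mem_neg {d : Dom S} {t : Ty S} : Mem d t.neg ↔ ¬ Mem d t := by
  rw [Mem]
  split <;> rename_i h <;> rw [Ty.view_neg] at h <;> cases h
  rfl

theorem mem_or {d : Dom S} {t s : Ty S} : Mem d (t.or s) ↔ Mem d t ∨ Mem d s := by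
  rw [Mem]
  split <;> rename_i h <;> rw [Ty.view_or] at h <;> cases h
  rfl

theorem mem_and {d : Dom S} {t s : Ty S} : Mem d (t.and s) ↔ Mem d t ∧ Mem d s := by
  rw [Ty.and, mem_neg, mem_or, mem_neg, mem_neg]
  tauto

/-- The test `τ` or its negation is a conjunct of the type. -/
inductive Ty.Settles (τ : TestTy S) : Ty S → Prop
  | pos (t : Ty S) : Settles τ (t.and τ.toTy)
  | neg (t : Ty S) : Settles τ (t.and τ.toTy.neg)
  | left {t : Ty S} (s : Ty S) : Settles τ t → Settles τ (t.and s)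

theorem Ty.Settles.sub {τ : TestTy S} {t : Ty S} (h : t.Settles τ) :
    t.Sub τ.toTy ∨ t.Sub τ.toTy.neg := by
  induction h with
  | pos t => exact .inl fun d hd => (mem_and.1 hd).2
  | neg t => exact .inr fun d hd => (mem_and.1 hd).2
  | left s _ ih => exact ih.imp (fun h d hd => h d (mem_and.1 hd).1) fun h d hd => h d (mem_and.1 hd).1

/-- This is the reason for a syntactic notion: it is stable under substitution without any appeal to
the interpretation of types. -/
theorem Ty.Settles.subst {τ : TestTy S} {t : Ty S} (h : t.Settles τ) (σ : Subst S) :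
    (t.subst σ).Settles τ := by
  induction h with
  | pos t => rw [subst_and, subst_toTy]; exact .pos _
  | neg t => rw [subst_and, subst_neg, subst_toTy]; exact .neg _
  | left s _ ih => rw [subst_and]; exact .left _ ih

/-! ### Knowledge on the environment -/

/-- What is known on the binding variables of an environment: `none` stands for a variable that can
be absent from it, and `some s` for one whose type settles the tests in `s`. -/
abbrev Know (S : Sig) : Type := ℕ → Option (Set (TestTy S))

namespace Know

/-- `k'` is at least as informative as `k`. -/
def Refines (k' k : Know S) : Prop := ∀ x s, k x = some s → ∃ s', k' x = some s' ∧ s ⊆ s'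

theorem Refines.refl (k : Know S) : k.Refines k := fun _ s h => ⟨s, h, subset_rfl⟩

/-- The knowledge in which `x` has a type that settles the tests in `s`. -/
def set (k : Know S) (x : ℕ) (s : Set (TestTy S)) : Know S := Function.update k x (some s)

theorem set_self (k : Know S) (x : ℕ) (s : Set (TestTy S)) : k.set x s x = some s := by simp [set]

theorem set_of_ne (k : Know S) {x y : ℕ} (h : y ≠ x) (s : Set (TestTy S)) :
    k.set x s y = k y := by simp [set, h]

theorem Refines.set {k' k : Know S} (h : k'.Refines k) (x : ℕ) {s' s : Set (TestTy S)}
    (hs : s ⊆ s') : (k'.set x s').Refines (k.set x s) := by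
  intro y r hr
  by_cases hy : y = x
  · subst hy
    rw [set_self] at hr ⊢
    obtain rfl := Option.some.inj hr
    exact ⟨s', rfl, hs⟩
  · rw [set_of_ne _ hy] at hr ⊢
    exact h y r hr

theorem set_comm (k : Know S) {x y : ℕ} (h : x ≠ y) (s r : Set (TestTy S)) :
    (k.set x s).set y r = (k.set y r).set x s := Function.update_comm h _ _ _

/-- The variable has to be absent: on a present one, `set` with `∅` would forget settled tests. -/
theorem refines_set_empty {k : Know S} {x : ℕ} (h : k x = none) : (k.set x ∅).Refines k := by
  intro y s hy
  have hne : y ≠ x := by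
    rintro rfl
    rw [h] at hy
    cases hy
  exact ⟨s, by rw [set_of_ne _ hne, hy], subset_rfl⟩

/-- The tests that are settled by the assumption of a type. -/
def tests (u : Ty S) : Set (TestTy S) := {τ | u = τ.toTy ∨ u = τ.toTy.neg}

/-- The knowledge obtained by assuming that the variables have the types of `G`. -/
def assume (k : Know S) (G : Env S) : Know S := fun x =>
  -- An assumption on an absent variable does not make it present.
  (k x).map fun s => s ∪ {τ | ∃ u, G.lookup (.bnd x) = some u ∧ τ ∈ tests u}

theorem assume_refines (k : Know S) (G : Env S) : (k.assume G).Refines k :=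
  fun x s h => ⟨_, by rw [assume, h]; rfl, Set.subset_union_left⟩

theorem assume_empty (k : Know S) : k.assume ∅ = k := by
  funext x
  simp [assume]

/-- For a variable bound by a definition, an assumption on it is absorbed into the tests settled by
its split, and only the rest of `G` concerns the surrounding environment. -/
theorem assume_set (k : Know S) (G : Env S) (x : ℕ) (s : Set (TestTy S)) :
    (k.set x s).assume G =
      (k.assume (G.erase (.bnd x))).set x
        (s ∪ {τ | ∃ u, G.lookup (.bnd x) = some u ∧ τ ∈ tests u}) := by
  funext y
  by_cases hy : y = x
  · subst hy
    simp [assume, set_self]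
  · rw [set_of_ne _ hy, assume, set_of_ne _ hy, assume, Finmap.lookup_erase_ne (by simpa using hy)]

theorem assume_set_of_notMem (k : Know S) {G : Env S} {x : ℕ} (h : Var.bnd x ∉ G)
    (s : Set (TestTy S)) : (k.set x s).assume G = (k.assume G).set x s := by
  funext y
  by_cases hy : y = x
  · subst hy
    simp [assume, set_self, Finmap.lookup_eq_none.2 h]
  · rw [set_of_ne _ hy, assume, set_of_ne _ hy, assume]

/-- Whether `x` can be absent, as a number. -/
def missing (k : Know S) (x : ℕ) : ℕ := if (k x).isNone then 1 else 0

open Classical in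
/-- Whether the type of `x` can leave the test `τ` open, as a number. -/
noncomputable def unsettled (k : Know S) (x : ℕ) (τ : TestTy S) : ℕ :=
  if ∃ s, k x = some s ∧ τ ∈ s then 0 else 1

theorem Refines.missing_le {k' k : Know S} (h : k'.Refines k) (x : ℕ) :
    k'.missing x ≤ k.missing x := by
  unfold missing
  cases hx : k x with
  | none => split <;> simp
  | some s =>
    obtain ⟨s', hs', -⟩ := h x s hx
    simp [hs']

theorem Refines.unsettled_le {k' k : Know S} (h : k'.Refines k) (x : ℕ) (τ : TestTy S) :
    k'.unsettled x τ ≤ k.unsettled x τ := by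
  unfold unsettled
  split_ifs with h₁ h₂ h₂
  · exact le_rfl
  · exact zero_le_one
  · obtain ⟨s, hs, hτ⟩ := h₂
    obtain ⟨s', hs', hss⟩ := h x s hs
    exact absurd ⟨s', hs', hss hτ⟩ h₁
  · exact le_rfl

end Know

/-- The tests settled by a type. -/
def Ty.settled (t : Ty S) : Set (TestTy S) := {τ | t.Settles τ}

theorem Ty.settled_subst (t : Ty S) (σ : Subst S) : t.settled ⊆ (t.subst σ).settled :=
  fun _ h => Ty.Settles.subst h σ

theorem Ty.settled_and (t u : Ty S) : t.settled ∪ Know.tests u ⊆ (t.and u).settled := by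
  rintro τ (h | rfl | rfl)
  exacts [.left u h, .pos t, .neg t]

/-- The environment `Γ` conforms to the knowledge `k`. -/
structure Env.Conforms (Γ : Env S) (k : Know S) : Prop where
  -- An equivalence is needed: a request for an absent variable lowers the weight only if `k` also
  -- has it absent.
  mem_iff : ∀ x, Var.bnd x ∈ Γ ↔ k x ≠ none
  -- This is semantic, like the guards of the type-case rules: a rule that splits on `τ` shows that
  -- `τ` is not among the settled tests.
  sub : ∀ x s t τ, k x = some s → Γ.lookup (.bnd x) = some t → τ ∈ s →
    t.Sub τ.toTy ∨ t.Sub τ.toTy.neg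

theorem Env.exists_conforms (Γ : Env S) : ∃ k : Know S, Γ.Conforms k := by
  classical
  refine ⟨fun x => if Var.bnd x ∈ Γ then some ∅ else none, ⟨fun x => ?_, fun x s t τ h _ hτ => ?_⟩⟩
  · by_cases h : Var.bnd x ∈ Γ <;> simp [h]
  · by_cases hx : Var.bnd x ∈ Γ
    · simp only [hx, if_true, Option.some.injEq] at h
      subst h
      exact hτ.elim
    · simp [hx] at h

theorem Env.Conforms.insert_lam {Γ : Env S} {k : Know S} (h : Γ.Conforms k) (x : ℕ) (t : Ty S) :
    Env.Conforms (Γ.insert (.lam x) t) k where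
  mem_iff y := by
    rw [Finmap.mem_insert, ← h.mem_iff]
    simp
  sub y s u τ hk hu := by
    rw [Finmap.lookup_insert_of_ne _ (by simp)] at hu
    exact h.sub y s u τ hk hu

/-- Only the split `t` is credited, not the type `s` of the atom, so that the weight of a split can
be read off from the annotation. -/
theorem Env.Conforms.insert_bnd {Γ : Env S} {k : Know S} (h : Γ.Conforms k) (x : ℕ) (s t : Ty S) :
    Env.Conforms (Γ.insert (.bnd x) (s.and t)) (k.set x t.settled) where
  mem_iff y := by
    rw [Finmap.mem_insert]
    by_cases hy : y = x
    · subst hy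
      simp [Know.set_self]
    · rw [Know.set_of_ne _ hy, ← h.mem_iff]
      simp [hy]
  sub y r u τ hk hu hτ := by
    by_cases hy : y = x
    · subst hy
      rw [Know.set_self] at hk
      rw [Finmap.lookup_insert] at hu
      obtain rfl := Option.some.inj hk
      obtain rfl := Option.some.inj hu
      exact (Ty.Settles.sub hτ).imp (fun h d hd => h d (mem_and.1 hd).2)
        fun h d hd => h d (mem_and.1 hd).2
    · rw [Know.set_of_ne _ hy] at hk
      rw [Finmap.lookup_insert_of_ne _ (by simpa using hy)] at hu
      exact h.sub y r u τ hk hu hτ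

open Weight

/-! ### Weights of annotations -/

/-- The contribution of an annotation of weight `w` of the body of a definition, where `v` is the
weight of the definition before any inference. It exceeds any sum of weights at most `v` and of
contributions of annotations lighter than `w`. -/
noncomputable def bodyWeight (v w : Weight) : Weight := pow (rank v + 1 + rank w)

mutual

/-- The weight of the annotation `infer` of an atom. -/
noncomputable def Atom.weight (k : Know S) : Atom S → Weight
  | .const _ => pow 0
  | .lvar _ => pow 0
  | .lam _ κ => pow (rank (Form.weight k κ) + 1)
  | .pair x₁ x₂ => pow ((1 + k.missing x₁ + k.missing x₂ : ℕ) : Ordinal)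
  | .app x₁ x₂ => pow ((1 + k.missing x₁ + k.missing x₂ : ℕ) : Ordinal)
  | .proj _ x => pow ((1 + k.missing x : ℕ) : Ordinal)
  -- The constant 2 leaves room below for `then_` and `else_`, of weight `pow 1`, which in turn lie
  -- above `typ` and `untyp`.
  | .tcase x τ _ _ => pow ((2 + k.missing x + k.unsettled x τ : ℕ) : Ordinal)

/-- The weight of the annotation `infer` of a form. -/
noncomputable def Form.weight (k : Know S) : Form S → Weight
  | .bvar x => pow ((1 + k.missing x : ℕ) : Ordinal)
  -- The final `+ 1` puts `infer` above `trySkip infer`. The atom is weighed with nothing known,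
  -- which bounds its weight whenever its inference may start.
  | .bind _ a κ =>
    pow (rank (bodyWeight (Atom.weight (fun _ => none) a) (Form.weight k κ)) + 1)

end

/-- The weight of the annotation `infer` of an expression. -/
noncomputable def Expr.weight (k : Know S) : Expr S → Weight
  | .atom a => a.weight k
  | .form κ => κ.weight k

/-- The weight of an atom about the variables of which nothing is known. -/
noncomputable def Atom.fullWeight (a : Atom S) : Weight := a.weight fun _ => none

mutual

/-- The weight of an annotation of an expression. -/
noncomputable def Ann.weight : Ann S → Expr S → Know S → Weight
  | .infer, η, k => η.weight k
  | .untyp, _, _ => pow 0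
  | .typ, _, _ => pow 0
  -- Finished members cost nothing. The summand `pow 0` puts the intersection strictly above each
  -- pending member, even if there is only one.
  | .inter S₁ _, η, k => Ann.listWeight S₁ η k + pow 0
  | .then_, _, _ => pow 1
  | .else_, _, _ => pow 1
  | .lam _ B, .atom (.lam _ κ), k => pow (rank (Ann.weight B (.form κ) k))
  | .trySkip B, .form (.bind _ a κ), k =>
    pow (rank (bodyWeight a.fullWeight (Ann.weight B (.form κ) k)))
  -- `B₁` is for the case in which `x` gets defined, with no test settled yet, and `B₂` for the case
  -- in which it is not.
  | .tryKeep A B₁ B₂, .form (.bind x a κ), k =>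
    pow (rank (bodyWeight a.fullWeight (Ann.weight B₁ (.form κ) (k.set x ∅)) +
      bodyWeight a.fullWeight (Ann.weight B₂ (.form κ) k) + Ann.weight A (.atom a) k))
  -- One unit for each environment still to be tried, and one for the passage to `keep`.
  | .prop _ Gs S₁ _, .form (.bind x a κ), k =>
    pow (rank (Ann.splitsWeight S₁ x a κ k + (Gs.length + 1) • pow 0))
  | .skip B, .form (.bind _ a κ), k =>
    pow (rank (bodyWeight a.fullWeight (Ann.weight B (.form κ) k)))
  -- The annotation of the atom and the finished splits need no further work and cost nothing.
  | .keep _ S₁ _, .form (.bind x a κ), k => pow (rank (Ann.splitsWeight S₁ x a κ k))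
  -- Annotations that do not fit the expression: no plain rule applies, and the value only has to be
  -- a single power.
  | _, _, _ => pow 0

/-- The sum of the weights of annotations of an expression. -/
noncomputable def Ann.listWeight : List (Ann S) → Expr S → Know S → Weight
  | [], _, _ => 0
  | A :: L, η, k => Ann.weight A η k + Ann.listWeight L η k

/-- The sum of the contributions of the splits of a definition. -/
noncomputable def Ann.splitsWeight : List (Ty S × Ann S) → ℕ → Atom S → Form S → Know S → Weight
  | [], _, _, _, _ => 0
  | (t, B) :: L, x, a, κ, k =>
    bodyWeight a.fullWeight (Ann.weight B (.form κ) (k.set x t.settled)) +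
      Ann.splitsWeight L x a κ k

end

-- Estimates for contributions and single powers

theorem bodyWeight_lt {v w w' : Weight} (h : w < w') : bodyWeight v w < bodyWeight v w' :=
  pow_lt_pow (by gcongr; exact rank_lt_rank h)

theorem bodyWeight_le {v w w' : Weight} (h : w ≤ w') : bodyWeight v w ≤ bodyWeight v w' :=
  pow_le_pow (by gcongr; exact rank_le_rank h)

theorem bodyWeight_pos (v w : Weight) : 0 < bodyWeight v w := pow_pos _

/-- This is the purpose of `rank v + 1` in the exponent: inference on the atom is paid for by the
contribution of the body. -/
theorem lt_bodyWeight (v w : Weight) : v < bodyWeight v w :=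
  (lt_pow_rank_add_one v).trans_le (pow_le_pow (le_add_of_nonneg_right bot_le))

theorem pow_zero_lt_bodyWeight (v w : Weight) : pow 0 < bodyWeight v w :=
  pow_lt_pow (lt_of_lt_of_le (by simp) (le_add_of_nonneg_right bot_le))

theorem pow_rank_lt {v w : Weight} (h : v < w) : pow (rank v) < pow (rank w) :=
  pow_lt_pow (rank_lt_rank h)

theorem pow_rank_le {v w : Weight} (h : v ≤ w) : pow (rank v) ≤ pow (rank w) :=
  pow_le_pow (rank_le_rank h)

theorem pow_natCast_le {m n : ℕ} (h : m ≤ n) : pow (m : Ordinal) ≤ pow (n : Ordinal) :=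
  pow_le_pow (by exact_mod_cast h)

theorem pow_natCast_lt {m n : ℕ} (h : m < n) : pow (m : Ordinal) < pow (n : Ordinal) :=
  pow_lt_pow (by exact_mod_cast h)

-- Weights are antitone in the knowledge. Needed because pending annotations are kept while
-- assumptions are added to the environment.
mutual

theorem Atom.weight_le {k' k : Know S} (h : k'.Refines k) : ∀ a : Atom S,
    a.weight k' ≤ a.weight k
  | .const _ | .lvar _ => by simp only [Atom.weight]; exact le_rfl
  | .lam _ κ => by
    simp only [Atom.weight]
    exact pow_le_pow (by gcongr; exact rank_le_rank (Form.weight_le h κ))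
  | .pair x₁ x₂ | .app x₁ x₂ => by
    simp only [Atom.weight]
    exact pow_natCast_le (by gcongr <;> exact h.missing_le _)
  | .proj _ x => by
    simp only [Atom.weight]
    exact pow_natCast_le (by gcongr; exact h.missing_le _)
  | .tcase x τ _ _ => by
    simp only [Atom.weight]
    exact pow_natCast_le (by gcongr; exacts [h.missing_le _, h.unsettled_le _ _])

theorem Form.weight_le {k' k : Know S} (h : k'.Refines k) : ∀ κ : Form S,
    κ.weight k' ≤ κ.weight k
  | .bvar x => by
    simp only [Form.weight]
    exact pow_natCast_le (by gcongr; exact h.missing_le _)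
  | .bind _ a κ => by
    simp only [Form.weight]
    exact pow_le_pow (by gcongr; exact rank_le_rank (bodyWeight_le (Form.weight_le h κ)))

end

theorem Expr.weight_le {k' k : Know S} (h : k'.Refines k) (η : Expr S) :
    η.weight k' ≤ η.weight k := by
  cases η with
  | atom a => exact a.weight_le h
  | form κ => exact κ.weight_le h

theorem Atom.weight_le_fullWeight (a : Atom S) (k : Know S) : a.weight k ≤ a.fullWeight :=
  a.weight_le fun _ _ h => by cases h

mutual

theorem Ann.weight_le {k' k : Know S} (h : k'.Refines k) : ∀ (A : Ann S) (η : Expr S),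
    A.weight η k' ≤ A.weight η k
  | .infer, η => by simp only [Ann.weight]; exact η.weight_le h
  | .untyp, _ | .typ, _ | .then_, _ | .else_, _ => by simp only [Ann.weight]; exact le_rfl
  | .inter S₁ _, η => by
    simp only [Ann.weight]
    gcongr
    exact Ann.listWeight_le h S₁ η
  | .lam _ B, .atom (.lam _ κ) => by
    simp only [Ann.weight]
    exact pow_rank_le (Ann.weight_le h B _)
  | .trySkip B, .form (.bind _ a κ) | .skip B, .form (.bind _ a κ) => by
    simp only [Ann.weight]
    exact pow_rank_le (bodyWeight_le (Ann.weight_le h B _))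
  | .tryKeep A B₁ B₂, .form (.bind x a κ) => by
    simp only [Ann.weight]
    exact pow_rank_le (add_le_add (add_le_add
      (bodyWeight_le (Ann.weight_le (h.set x subset_rfl) B₁ _))
      (bodyWeight_le (Ann.weight_le h B₂ _))) (Ann.weight_le h A _))
  | .prop _ Gs S₁ _, .form (.bind x a κ) => by
    simp only [Ann.weight]
    exact pow_rank_le (add_le_add (Ann.splitsWeight_le h S₁ x a κ) le_rfl)
  | .keep _ S₁ _, .form (.bind x a κ) => by
    simp only [Ann.weight]
    exact pow_rank_le (Ann.splitsWeight_le h S₁ x a κ)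
  | .lam _ _, .form _ | .lam _ _, .atom (.const _) | .lam _ _, .atom (.lvar _)
  | .lam _ _, .atom (.pair _ _) | .lam _ _, .atom (.app _ _) | .lam _ _, .atom (.proj _ _)
  | .lam _ _, .atom (.tcase _ _ _ _)
  | .trySkip _, .atom _ | .trySkip _, .form (.bvar _) | .skip _, .atom _ | .skip _, .form (.bvar _)
  | .tryKeep _ _ _, .atom _ | .tryKeep _ _ _, .form (.bvar _)
  | .prop _ _ _ _, .atom _ | .prop _ _ _ _, .form (.bvar _)
  | .keep _ _ _, .atom _ | .keep _ _ _, .form (.bvar _) => by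
    simp only [Ann.weight]
    exact le_rfl

theorem Ann.listWeight_le {k' k : Know S} (h : k'.Refines k) : ∀ (L : List (Ann S)) (η : Expr S),
    Ann.listWeight L η k' ≤ Ann.listWeight L η k
  | [], _ => by simp only [Ann.listWeight]; exact le_rfl
  | A :: L, η => by
    simp only [Ann.listWeight]
    exact add_le_add (Ann.weight_le h A η) (Ann.listWeight_le h L η)

theorem Ann.splitsWeight_le {k' k : Know S} (h : k'.Refines k) :
    ∀ (L : List (Ty S × Ann S)) (x : ℕ) (a : Atom S) (κ : Form S),
    Ann.splitsWeight L x a κ k' ≤ Ann.splitsWeight L x a κ k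
  | [], _, _, _ => by simp only [Ann.splitsWeight]; exact le_rfl
  | (t, B) :: L, x, a, κ => by
    simp only [Ann.splitsWeight]
    exact add_le_add (bodyWeight_le (Ann.weight_le (h.set x subset_rfl) B _))
      (Ann.splitsWeight_le h L x a κ)

end

-- A substitution preserves the shape of an annotation and the number of its environments; the types
-- enter only through the tests settled by splits, which it can only increase.
mutual

theorem Ann.weight_subst_le (σ : Subst S) {k' k : Know S} (h : k'.Refines k) :
    ∀ (A : Ann S) (η : Expr S), (A.subst σ).weight η k' ≤ A.weight η k
  | .infer, η => by simp only [Ann.subst, Ann.weight]; exact η.weight_le h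
  | .untyp, _ | .typ, _ | .then_, _ | .else_, _ => by
    simp only [Ann.subst, Ann.weight]
    exact le_rfl
  | .inter S₁ _, η => by
    simp only [Ann.subst, Ann.weight]
    gcongr
    exact Ann.listWeight_subst_le σ h S₁ η
  | .lam _ B, .atom (.lam _ κ) => by
    simp only [Ann.subst, Ann.weight]
    exact pow_rank_le (Ann.weight_subst_le σ h B _)
  | .trySkip B, .form (.bind _ a κ) | .skip B, .form (.bind _ a κ) => by
    simp only [Ann.subst, Ann.weight]
    exact pow_rank_le (bodyWeight_le (Ann.weight_subst_le σ h B _))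
  | .tryKeep A B₁ B₂, .form (.bind x a κ) => by
    simp only [Ann.subst, Ann.weight]
    exact pow_rank_le (add_le_add (add_le_add
      (bodyWeight_le (Ann.weight_subst_le σ (h.set x subset_rfl) B₁ _))
      (bodyWeight_le (Ann.weight_subst_le σ h B₂ _))) (Ann.weight_subst_le σ h A _))
  | .prop _ Gs S₁ _, .form (.bind x a κ) => by
    simp only [Ann.subst, Ann.weight, List.length_map]
    exact pow_rank_le (add_le_add (Ann.splitsWeight_subst_le σ h S₁ x a κ) le_rfl)
  | .keep _ S₁ _, .form (.bind x a κ) => by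
    simp only [Ann.subst, Ann.weight]
    exact pow_rank_le (Ann.splitsWeight_subst_le σ h S₁ x a κ)
  | .lam _ _, .form _ | .lam _ _, .atom (.const _) | .lam _ _, .atom (.lvar _)
  | .lam _ _, .atom (.pair _ _) | .lam _ _, .atom (.app _ _) | .lam _ _, .atom (.proj _ _)
  | .lam _ _, .atom (.tcase _ _ _ _)
  | .trySkip _, .atom _ | .trySkip _, .form (.bvar _) | .skip _, .atom _ | .skip _, .form (.bvar _)
  | .tryKeep _ _ _, .atom _ | .tryKeep _ _ _, .form (.bvar _)
  | .prop _ _ _ _, .atom _ | .prop _ _ _ _, .form (.bvar _)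
  | .keep _ _ _, .atom _ | .keep _ _ _, .form (.bvar _) => by
    simp only [Ann.subst, Ann.weight]
    exact le_rfl

theorem Ann.listWeight_subst_le (σ : Subst S) {k' k : Know S} (h : k'.Refines k) :
    ∀ (L : List (Ann S)) (η : Expr S),
    Ann.listWeight (Ann.substList σ L) η k' ≤ Ann.listWeight L η k
  | [], _ => by simp only [Ann.substList, Ann.listWeight]; exact le_rfl
  | A :: L, η => by
    simp only [Ann.substList, Ann.listWeight]
    exact add_le_add (Ann.weight_subst_le σ h A η) (Ann.listWeight_subst_le σ h L η)

theorem Ann.splitsWeight_subst_le (σ : Subst S) {k' k : Know S} (h : k'.Refines k) :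
    ∀ (L : List (Ty S × Ann S)) (x : ℕ) (a : Atom S) (κ : Form S),
    Ann.splitsWeight (Ann.substSplits σ L) x a κ k' ≤ Ann.splitsWeight L x a κ k
  | [], _, _, _ => by simp only [Ann.substSplits, Ann.splitsWeight]; exact le_rfl
  | (t, B) :: L, x, a, κ => by
    simp only [Ann.substSplits, Ann.splitsWeight]
    exact add_le_add
      (bodyWeight_le (Ann.weight_subst_le σ (h.set x (t.settled_subst σ)) B _))
      (Ann.splitsWeight_subst_le σ h L x a κ)

end

/-- Sums of weights below such an annotation stay below it, so it may be replaced by an intersection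
of lighter annotations. -/
theorem Ann.weight_eq_pow (A : Ann S) (hA : ∀ S₁ S₂, A ≠ .inter S₁ S₂) (η : Expr S) (k : Know S) :
    ∃ o, A.weight η k = pow o := by
  cases A with
  | inter S₁ S₂ => exact absurd rfl (hA S₁ S₂)
  | _ =>
    rcases η with (_ | _ | _ | _ | _ | _ | _) | (_ | _) <;>
      simp only [Ann.weight, Expr.weight, Atom.weight, Form.weight] <;> exact ⟨_, rfl⟩

/-! ### Removal of elements -/

mutual

theorem Ann.eqv_refl : ∀ A : Ann S, A.Eqv A
  | .infer => .infer
  | .untyp => .untyp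
  | .typ => .typ
  | .inter S₁ S₂ => .inter (S₁.map fun A => (A, A)) (S₂.map fun A => (A, A))
      (List.forall_mem_map.2 (Ann.eqv_refl_list S₁)) (by simp [SameElems]) (by simp [SameElems])
      (List.forall_mem_map.2 (Ann.eqv_refl_list S₂)) (by simp [SameElems]) (by simp [SameElems])
  | .then_ => .then_
  | .else_ => .else_
  | .lam _ B => .lam (Ann.eqv_refl B)
  | .trySkip B => .trySkip (Ann.eqv_refl B)
  | .tryKeep A B₁ B₂ => .tryKeep (Ann.eqv_refl A) (Ann.eqv_refl B₁) (Ann.eqv_refl B₂)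
  | .prop A Gs S₁ S₂ => .prop (S₁.map fun p => (p.1, p.2, p.2)) (S₂.map fun p => (p.1, p.2, p.2))
      (Ann.eqv_refl A) (fun _ => Iff.rfl)
      (List.forall_mem_map.2 (Ann.eqv_refl_splits S₁)) (by simp [SameElems]) (by simp [SameElems])
      (List.forall_mem_map.2 (Ann.eqv_refl_splits S₂)) (by simp [SameElems]) (by simp [SameElems])
  | .skip B => .skip (Ann.eqv_refl B)
  | .keep A S₁ S₂ => .keep (S₁.map fun p => (p.1, p.2, p.2)) (S₂.map fun p => (p.1, p.2, p.2))
      (Ann.eqv_refl A)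
      (List.forall_mem_map.2 (Ann.eqv_refl_splits S₁)) (by simp [SameElems]) (by simp [SameElems])
      (List.forall_mem_map.2 (Ann.eqv_refl_splits S₂)) (by simp [SameElems]) (by simp [SameElems])

theorem Ann.eqv_refl_list : ∀ L : List (Ann S), ∀ A ∈ L, A.Eqv A
  | [] => by simp
  | A :: L => List.forall_mem_cons.2 ⟨Ann.eqv_refl A, Ann.eqv_refl_list L⟩

theorem Ann.eqv_refl_splits : ∀ L : List (Ty S × Ann S), ∀ p ∈ L, p.2.Eqv p.2
  | [] => by simp
  | (_, A) :: L => List.forall_mem_cons.2 ⟨Ann.eqv_refl A, Ann.eqv_refl_splits L⟩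

end

theorem Ann.listWeight_eq_sum (L : List (Ann S)) (η : Expr S) (k : Know S) :
    Ann.listWeight L η k = (L.map fun A => A.weight η k).sum := by
  induction L with
  | nil => simp only [Ann.listWeight, List.map_nil, List.sum_nil]
  | cons A L ih => simp only [Ann.listWeight, List.map_cons, List.sum_cons, ih]

theorem Ann.splitsWeight_eq_sum (L : List (Ty S × Ann S)) (x : ℕ) (a : Atom S) (κ : Form S)
    (k : Know S) : Ann.splitsWeight L x a κ k =
      (L.map fun p => bodyWeight a.fullWeight
        (p.2.weight (.form κ) (k.set x p.1.settled))).sum := by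
  induction L with
  | nil => simp only [Ann.splitsWeight, List.map_nil, List.sum_nil]
  | cons p L ih => simp only [Ann.splitsWeight, List.map_cons, List.sum_cons, ih]

/-- Removing an element of a set represented by a list may discard several entries, which only
lowers the sum. Of the equivalence of annotations, just reflexivity is used: the chosen entry itself
is discarded. -/
theorem add_sum_filter_le {X : Type} (w : X → Weight) (p : X → Bool) {x : X} {L : List X}
    (hx : x ∈ L) (hp : p x = false) :
    w x + ((L.filter p).map w).sum ≤ (L.map w).sum := by
  have key : ∀ L : List X, ((L.filter p).map w).sum ≤ (L.map w).sum := by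
    intro L
    induction L with
    | nil => exact le_rfl
    | cons y L ih =>
      rw [List.filter_cons]
      split
      · simpa using add_le_add_right ih (w y)
      · simpa using ih.trans (le_add_of_nonneg_left (zero_le (w y)))
  induction L with
  | nil => simp at hx
  | cons y L ih =>
    rw [List.filter_cons]
    rcases List.mem_cons.1 hx with rfl | hx
    · simpa [hp] using add_le_add_right (key L) (w x)
    · split
      · simpa [add_left_comm (w x)] using add_le_add_right (ih hx) (w y)
      · simpa using (ih hx).trans (le_add_of_nonneg_left (zero_le (w y)))

theorem Ann.add_remove_le {L : List (Ann S)} {A : Ann S} (h : A ∈ L) (η : Expr S) (k : Know S) :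
    A.weight η k + Ann.listWeight (Ann.remove L A) η k ≤ Ann.listWeight L η k := by
  rw [Ann.listWeight_eq_sum, Ann.listWeight_eq_sum]
  refine add_sum_filter_le (fun A => A.weight η k) _ h ?_
  simp [A.eqv_refl]

theorem Ann.add_removeSplit_le {L : List (Ty S × Ann S)} {t : Ty S} {B : Ann S} (h : (t, B) ∈ L)
    (x : ℕ) (a : Atom S) (κ : Form S) (k : Know S) :
    bodyWeight a.fullWeight (B.weight (.form κ) (k.set x t.settled)) +
      Ann.splitsWeight (Ann.removeSplit L (t, B)) x a κ k ≤ Ann.splitsWeight L x a κ k := by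
  rw [Ann.splitsWeight_eq_sum, Ann.splitsWeight_eq_sum]
  refine add_sum_filter_le (fun p : Ty S × Ann S => bodyWeight a.fullWeight
    (p.2.weight (.form κ) (k.set x p.1.settled))) _ h ?_
  simp [B.eqv_refl]

theorem Ann.length_removeEnv_lt {L : List (Env S)} {G : Env S} (h : G ∈ L) :
    (Ann.removeEnv L G).length < L.length :=
  List.length_filter_lt_length_iff_exists.2 ⟨G, h, by simp⟩

/-! ### Comparison of the weights of annotations -/

namespace Ann

theorem pow_zero_le_weight (A : Ann S) (η : Expr S) (k : Know S) : pow 0 ≤ A.weight η k := by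
  by_cases hA : ∃ S₁ S₂, A = .inter S₁ S₂
  · obtain ⟨S₁, S₂, rfl⟩ := hA
    simp only [Ann.weight]
    exact le_add_of_nonneg_left (zero_le _)
  · obtain ⟨o, ho⟩ := A.weight_eq_pow (fun S₁ S₂ h => hA ⟨S₁, S₂, h⟩) η k
    rw [ho]
    exact pow_le_pow bot_le

theorem weight_pos (A : Ann S) (η : Expr S) (k : Know S) : 0 < A.weight η k :=
  (pow_pos 0).trans_le (A.pow_zero_le_weight η k)

variable {η : Expr S} {k k' : Know S} {x : ℕ} {a : Atom S} {κ : Form S}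

theorem weight_lam_infer_lt (t : Ty S) : (Ann.lam t .infer).weight (.atom (.lam x κ)) k <
    Ann.infer.weight (.atom (.lam x κ)) k := by
  simp only [Ann.weight, Expr.weight, Atom.weight]
  exact pow_lt_pow (Order.lt_add_one_iff.2 le_rfl)

theorem weight_trySkip_infer_lt : (Ann.trySkip .infer).weight (.form (.bind x a κ)) k <
    Ann.infer.weight (.form (.bind x a κ)) k := by
  simp only [Ann.weight, Expr.weight, Form.weight]
  exact pow_lt_pow (Order.lt_add_one_iff.2 le_rfl)

/-- The contribution of `B` is a single power that exceeds the contributions of `B₁` and `B₂` and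
the cost of inference on the atom, hence also their sum. -/
theorem weight_tryKeep_infer_lt {B B₁ B₂ : Ann S}
    (h₁ : B₁.weight (.form κ) (k.set x ∅) < B.weight (.form κ) k)
    (h₂ : B₂.weight (.form κ) k < B.weight (.form κ) k) :
    (Ann.tryKeep .infer B₁ B₂).weight (.form (.bind x a κ)) k <
      (Ann.trySkip B).weight (.form (.bind x a κ)) k := by
  simp only [Ann.weight, Expr.weight]
  exact pow_rank_lt (add_lt_pow (add_lt_pow (bodyWeight_lt h₁) (bodyWeight_lt h₂))
    ((a.weight_le_fullWeight k).trans_lt (lt_bodyWeight _ _)))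

theorem weight_lam_lt {t t' : Ty S} {X B : Ann S}
    (h : X.weight (.form κ) k' < B.weight (.form κ) k) :
    (Ann.lam t X).weight (.atom (.lam x κ)) k' < (Ann.lam t' B).weight (.atom (.lam x κ)) k := by
  simp only [Ann.weight]
  exact pow_rank_lt h

theorem weight_trySkip_lt {X B : Ann S} (h : X.weight (.form κ) k' < B.weight (.form κ) k) :
    (Ann.trySkip X).weight (.form (.bind x a κ)) k' <
      (Ann.trySkip B).weight (.form (.bind x a κ)) k := by
  simp only [Ann.weight]
  exact pow_rank_lt (bodyWeight_lt h)

theorem weight_skip_lt {X B : Ann S} (h : X.weight (.form κ) k' < B.weight (.form κ) k) :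
    (Ann.skip X).weight (.form (.bind x a κ)) k' <
      (Ann.skip B).weight (.form (.bind x a κ)) k := by
  simp only [Ann.weight]
  exact pow_rank_lt (bodyWeight_lt h)

theorem weight_tryKeep_lt {X A B₁ B₂ : Ann S} (hk : k'.Refines k)
    (h : X.weight (.atom a) k' < A.weight (.atom a) k) :
    (Ann.tryKeep X B₁ B₂).weight (.form (.bind x a κ)) k' <
      (Ann.tryKeep A B₁ B₂).weight (.form (.bind x a κ)) k := by
  simp only [Ann.weight]
  exact pow_rank_lt (add_lt_add_of_le_of_lt
    (add_le_add (bodyWeight_le (B₁.weight_le (hk.set x subset_rfl) _))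
      (bodyWeight_le (B₂.weight_le hk _))) h)

/-- The strict decrease comes from dropping the alternative `B₂`, whose contribution is positive. -/
theorem weight_keep_any_lt (A A' B₁ B₂ : Ann S) :
    (Ann.keep A' [(.any, B₁)] []).weight (.form (.bind x a κ)) k <
      (Ann.tryKeep A B₁ B₂).weight (.form (.bind x a κ)) k := by
  simp only [Ann.weight, Ann.splitsWeight]
  refine pow_rank_lt (add_lt_add_of_lt_of_le ?_ (zero_le _))
  exact (bodyWeight_le (B₁.weight_le ((Know.Refines.refl k).set x (Set.empty_subset _)) _)).trans_lt
    (lt_add_of_pos_right _ (bodyWeight_pos _ _))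

theorem weight_skip_lt_tryKeep (A B₁ B₂ : Ann S) :
    (Ann.skip B₂).weight (.form (.bind x a κ)) k <
      (Ann.tryKeep A B₁ B₂).weight (.form (.bind x a κ)) k := by
  simp only [Ann.weight]
  exact pow_rank_lt ((lt_add_of_pos_left _ (bodyWeight_pos _ _)).trans_le
    (le_add_of_nonneg_right (zero_le _)))

theorem weight_keep_removeSplit_lt (A A' : Ann S) {S₁ : List (Ty S × Ann S)} {t : Ty S} {B : Ann S}
    (h : (t, B) ∈ S₁) (S₂ S₂' : List (Ty S × Ann S)) :
    (Ann.keep A' (Ann.removeSplit S₁ (t, B)) S₂').weight (.form (.bind x a κ)) k <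
      (Ann.keep A S₁ S₂).weight (.form (.bind x a κ)) k := by
  simp only [Ann.weight]
  exact pow_rank_lt ((lt_add_of_pos_left _ (bodyWeight_pos _ _)).trans_le
    (Ann.add_removeSplit_le h x a κ k))

theorem weight_keep_lt {A : Ann S} {S₁ : List (Ty S × Ann S)} {t : Ty S} {B X : Ann S}
    (h : (t, B) ∈ S₁) (S₂ : List (Ty S × Ann S)) (hk : k'.Refines k)
    (hX : X.weight (.form κ) (k'.set x t.settled) < B.weight (.form κ) (k.set x t.settled)) :
    (Ann.keep A ((t, X) :: Ann.removeSplit S₁ (t, B)) S₂).weight (.form (.bind x a κ)) k' <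
      (Ann.keep A S₁ S₂).weight (.form (.bind x a κ)) k := by
  simp only [Ann.weight, Ann.splitsWeight]
  exact pow_rank_lt ((add_lt_add_of_lt_of_le (bodyWeight_lt hX)
    (Ann.splitsWeight_le hk _ x a κ)).trans_le (Ann.add_removeSplit_le h x a κ k))

/-- The contribution of `B` pays for two lighter bodies and for any number of environments to
propagate, the latter being multiples of `pow 0`. -/
theorem weight_prop_lt_keep {A : Ann S} {Gs : List (Env S)} {S₁ : List (Ty S × Ann S)}
    {t t₁ t₂ : Ty S} {B B₁ B₂ : Ann S}
    (h : (t, B) ∈ S₁) (S₂ : List (Ty S × Ann S)) (hk : k'.Refines k)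
    (h₁ : B₁.weight (.form κ) (k'.set x t₁.settled) < B.weight (.form κ) (k.set x t.settled))
    (h₂ : B₂.weight (.form κ) (k'.set x t₂.settled) < B.weight (.form κ) (k.set x t.settled)) :
    (Ann.prop A Gs ((t₁, B₁) :: (t₂, B₂) :: Ann.removeSplit S₁ (t, B)) S₂).weight
        (.form (.bind x a κ)) k' <
      (Ann.keep A S₁ S₂).weight (.form (.bind x a κ)) k := by
  simp only [Ann.weight, Ann.splitsWeight]
  refine pow_rank_lt (lt_of_lt_of_le ?_ (Ann.add_removeSplit_le h x a κ k))
  rw [← add_assoc, add_right_comm]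
  exact add_lt_add_of_lt_of_le (add_lt_pow (add_lt_pow (bodyWeight_lt h₁) (bodyWeight_lt h₂))
    (nsmul_lt_pow (pow_zero_lt_bodyWeight _ _) _)) (Ann.splitsWeight_le hk _ x a κ)

theorem weight_keep_lt_prop (A A' : Ann S) (Gs : List (Env S)) (S₁ S₂ S₂' : List (Ty S × Ann S)) :
    (Ann.keep A S₁ S₂).weight (.form (.bind x a κ)) k <
      (Ann.prop A' Gs S₁ S₂').weight (.form (.bind x a κ)) k := by
  simp only [Ann.weight]
  refine pow_rank_lt (lt_add_of_pos_right _ ?_)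
  rw [succ_nsmul]
  exact (pow_pos 0).trans_le (le_add_of_nonneg_left (zero_le _))

theorem weight_prop_removeEnv_lt (A : Ann S) {Gs : List (Env S)} {G : Env S} (h : G ∈ Gs)
    (S₁ S₂ : List (Ty S × Ann S)) :
    (Ann.prop A (Ann.removeEnv Gs G) S₁ S₂).weight (.form (.bind x a κ)) k <
      (Ann.prop A Gs S₁ S₂).weight (.form (.bind x a κ)) k := by
  simp only [Ann.weight]
  refine pow_rank_lt (add_lt_add_right ?_ _)
  -- `n + 1` entries disappear; the multiple of `pow 0` is cut accordingly.
  obtain ⟨n, hn⟩ := Nat.exists_eq_add_of_lt (Ann.length_removeEnv_lt h)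
  rw [hn, add_right_comm, add_nsmul _ ((Ann.removeEnv Gs G).length + n + 1) 1, one_nsmul,
    add_right_comm, add_nsmul _ _ n, add_assoc]
  refine lt_add_of_pos_right _ ((pow_pos 0).trans_le (le_add_of_nonneg_left (zero_le _)))

theorem weight_lt_inter {S₁ : List (Ann S)} {A : Ann S} (h : A ∈ S₁) (S₂ : List (Ann S)) :
    A.weight η k < (Ann.inter S₁ S₂).weight η k := by
  simp only [Ann.weight]
  exact ((le_add_of_nonneg_right (zero_le _)).trans (Ann.add_remove_le h η k)).trans_lt
    (lt_add_of_pos_right _ (pow_pos 0))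

theorem weight_inter_remove_lt {S₁ : List (Ann S)} {A : Ann S} (h : A ∈ S₁) (S₂ S₂' : List (Ann S)) :
    (Ann.inter (Ann.remove S₁ A) S₂').weight η k < (Ann.inter S₁ S₂).weight η k := by
  simp only [Ann.weight]
  exact add_lt_add_of_lt_of_le ((lt_add_of_pos_left _ (A.weight_pos η k)).trans_le
    (Ann.add_remove_le h η k)) le_rfl

theorem weight_inter_lt {S₁ : List (Ann S)} {A X : Ann S} (h : A ∈ S₁) (S₂ : List (Ann S))
    (hk : k'.Refines k) (hX : X.weight η k' < A.weight η k) :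
    (Ann.inter (X :: Ann.remove S₁ A) S₂).weight η k' < (Ann.inter S₁ S₂).weight η k := by
  simp only [Ann.weight, Ann.listWeight]
  exact add_lt_add_of_lt_of_le ((add_lt_add_of_lt_of_le hX (Ann.listWeight_le hk _ η)).trans_le
    (Ann.add_remove_le h η k)) le_rfl

/-- For an intersection `A` this can fail, as its weight need not be a single power. The extra `pow
0` is covered too, since it is at most the weight of any member of `L`; hence `L` has to be
nonempty. -/
theorem weight_inter_lt_of_forall_lt {A : Ann S} (hA : ∀ S₁ S₂, A ≠ .inter S₁ S₂)
    {L : List (Ann S)} (hne : L ≠ []) (hL : ∀ X ∈ L, X.weight η k < A.weight η k) :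
    (Ann.inter L []).weight η k < A.weight η k := by
  obtain ⟨o, ho⟩ := A.weight_eq_pow hA η k
  obtain ⟨X, hX⟩ := List.exists_mem_of_ne_nil L hne
  have h₀ := (X.pow_zero_le_weight η k).trans_lt (hL X hX)
  rw [ho] at hL h₀ ⊢
  simp only [Ann.weight, Ann.listWeight_eq_sum]
  refine add_lt_pow (sum_lt_pow fun w hw => ?_) h₀
  obtain ⟨X, hX, rfl⟩ := List.mem_map.1 hw
  exact hL X hX

end Ann

/-! ### Results of the iterated judgment -/

theorem Res.iterable_map (f : Ann S → Ann S) (Γ : Env S) (r : Res S) :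
    (r.map f).Iterable Γ ↔ r.Iterable Γ := by
  cases r <;> exact Iff.rfl

/-- An iterated judgment stops only at a result that cannot be iterated, and an intersection returns
only `ok`, `fail`, or results of iterated judgments on its members, up to a map. So a plain
evaluation of an intersection never triggers an iteration step. -/
theorem Derives.not_iterable {c : Call S} {r : Res S} (h : Derives c r)
    (hc : c.mode = .iter ∨ ∃ S₁ S₂, c.ann = .inter S₁ S₂) : ¬ r.Iterable c.env := by
  induction h with
  | mk h _ ih =>
    cases h
    case iterate₁ | iterate₂ => exact ih _ (List.mem_cons_of_mem _ (List.mem_singleton_self _)) (.inl rfl)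
    case iterStop h _ => exact h
    case inter₁ | inter₂ =>
      exact ih _ (List.mem_cons_of_mem _ (List.mem_singleton_self _)) (.inr ⟨_, _, rfl⟩)
    case inter₃ =>
      rw [Res.iterable_map]
      exact ih _ (List.mem_singleton_self _) (.inl rfl)
    case interEmpty | interOk => exact id
    all_goals
      rcases hc with hc | ⟨_, _, hc⟩ <;> cases hc

/-! ### Results lower the weight -/

/-- The annotations of the result have weights below `w`, under the additional assumptions that
they are meant for. -/
def Res.Lowers (Γ : Env S) (η : Expr S) (k : Know S) (w : Weight) : Res S → Prop
  | .ok _ => True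
  | .fail => True
  -- Three origins of `A₂`: for empty `G` it is never used; after propagation or in a pending `keep`
  -- it is lighter outright; after a split on a type-case it is again `infer`, lighter only under
  -- the negated assumption.
  | .part G A₁ A₂ => A₁.weight η (k.assume G) < w ∧ (G = ∅ ∨ A₂.weight η k < w ∨
      ∃ x u, G = Finmap.singleton (.bnd x) u ∧
        A₂.weight η (k.assume (Finmap.singleton (.bnd x) u.neg)) < w)
  | .subst _ A₁ A₂ => A₁.weight η k < w ∧ A₂.weight η k < w
  | .var x A₁ A₂ => Var.bnd x ∉ Γ ∧ A₁.weight η (k.set x ∅) < w ∧ A₂.weight η k < w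

theorem Res.Lowers.mono {Γ : Env S} {η : Expr S} {k : Know S} {w w' : Weight} {r : Res S}
    (h : r.Lowers Γ η k w) (hw : w ≤ w') : r.Lowers Γ η k w' := by
  cases r with
  | ok => trivial
  | fail => trivial
  | part G A₁ A₂ =>
    refine ⟨h.1.trans_le hw, h.2.imp_right (Or.imp (fun h => h.trans_le hw) ?_)⟩
    rintro ⟨x, u, hG, h⟩
    exact ⟨x, u, hG, h.trans_le hw⟩
  | subst => exact ⟨h.1.trans_le hw, h.2.trans_le hw⟩
  | var => exact ⟨h.1, h.2.1.trans_le hw, h.2.2.trans_le hw⟩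

/-- For rules that rebuild the annotations of a premise's result. `g` sends the knowledge of the
conclusion to that of the premise; it has to commute with the assumptions made in the result, so
that `hf` can be applied with the refined outer knowledge. -/
theorem Res.Lowers.map {Γ Γ' : Env S} {η η' : Expr S} {k : Know S} {w w' : Weight} {r : Res S}
    {f : Ann S → Ann S} (g : Know S → Know S) (h : r.Lowers Γ η (g k) w) (hk : Γ'.Conforms k)
    (hΓ : ∀ y, Var.bnd y ∉ Γ → Var.bnd y ∉ Γ')
    (hpart : ∀ G A₁ A₂, r = .part G A₁ A₂ → ∀ G' : Env S, (∀ y ∈ G', y ∈ G) →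
      (g k).assume G' = g (k.assume G'))
    (hvar : ∀ y, Var.bnd y ∉ Γ → (g k).set y ∅ = g (k.set y ∅))
    (hf : ∀ X k', k'.Refines k → X.weight η (g k') < w → (f X).weight η' k' < w') :
    (r.map f).Lowers Γ' η' k w' := by
  cases r with
  | ok => trivial
  | fail => trivial
  | part G A₁ A₂ =>
    have hp := hpart G A₁ A₂ rfl
    refine ⟨hf _ _ (k.assume_refines G) (hp G (fun _ h => h) ▸ h.1), h.2.imp_right (Or.imp ?_ ?_)⟩
    · exact hf _ _ (.refl k)
    · rintro ⟨x, u, rfl, h₂⟩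
      refine ⟨x, u, rfl, hf _ _ (k.assume_refines _) ?_⟩
      rw [← hp _ (by simp)]
      exact h₂
  | subst => exact ⟨hf _ _ (.refl k) h.1, hf _ _ (.refl k) h.2⟩
  | var y A₁ A₂ =>
    have hy := hΓ y h.1
    have hy' : k y = none := by
      by_contra hne
      exact hy ((hk.mem_iff y).2 hne)
    exact ⟨hy, hf _ _ (Know.refines_set_empty hy') (hvar y h.1 ▸ h.2.1), hf _ _ (.refl k) h.2.2⟩

/-- The case of `Res.Lowers.map` in which the environment is not changed. -/
theorem Res.Lowers.map_same {Γ Γ' : Env S} {η η' : Expr S} {k : Know S} {w w' : Weight} {r : Res S}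
    {f : Ann S → Ann S} (h : r.Lowers Γ η k w) (hk : Γ'.Conforms k)
    (hΓ : ∀ y, Var.bnd y ∉ Γ → Var.bnd y ∉ Γ')
    (hf : ∀ X k', k'.Refines k → X.weight η k' < w → (f X).weight η' k' < w') :
    (r.map f).Lowers Γ' η' k w' :=
  h.map id hk hΓ (fun _ _ _ _ _ _ => rfl) (fun _ _ => rfl) hf

-- Progress through variables made present and tests settled

theorem Know.missing_eq_one {Γ : Env S} {k : Know S} (hk : Γ.Conforms k) {x : ℕ}
    (h : Var.bnd x ∉ Γ) : k.missing x = 1 := by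
  have hx : k x = none := by
    by_contra hne
    exact h ((hk.mem_iff x).2 hne)
  simp [Know.missing, hx]

theorem Know.missing_set_self (k : Know S) (x : ℕ) (s : Set (TestTy S)) :
    (k.set x s).missing x = 0 := by
  simp [Know.missing, Know.set_self]

theorem Know.missing_set_lt {Γ : Env S} {k : Know S} (hk : Γ.Conforms k) {x : ℕ}
    (h : Var.bnd x ∉ Γ) : (k.set x ∅).missing x < k.missing x := by
  rw [Know.missing_set_self, Know.missing_eq_one hk h]
  exact zero_lt_one

theorem Know.refines_set_of_notMem {Γ : Env S} {k : Know S} (hk : Γ.Conforms k) {x : ℕ}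
    (h : Var.bnd x ∉ Γ) : (k.set x ∅).Refines k :=
  Know.refines_set_empty (by
    by_contra hne
    exact h ((hk.mem_iff x).2 hne))

/-- Assuming that the outcome of an open test is known settles it. -/
theorem Know.unsettled_assume_lt {Γ : Env S} {k : Know S} (hk : Γ.Conforms k) {x : ℕ} {t u : Ty S}
    {τ : TestTy S} (hx : Γ.lookup (.bnd x) = some t) (h₁ : ¬ t.Sub τ.toTy)
    (h₂ : ¬ t.Sub τ.toTy.neg) (hu : τ ∈ Know.tests u) :
    (k.assume (Finmap.singleton (.bnd x) u)).unsettled x τ < k.unsettled x τ := by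
  have hmem : k x ≠ none := (hk.mem_iff x).1 (Finmap.mem_of_lookup_eq_some hx)
  obtain ⟨s, hs⟩ := Option.ne_none_iff_exists'.1 hmem
  have hτ : τ ∉ s := fun h => (hk.sub x s t τ hs hx h).elim h₁ h₂
  have h₀ : (k.assume (Finmap.singleton (.bnd x) u)).unsettled x τ = 0 :=
    if_pos ⟨s ∪ {τ | ∃ u', Finmap.lookup (Var.bnd x) (Finmap.singleton (Var.bnd x) u : Env S) = some u' ∧
      τ ∈ Know.tests u'}, by rw [Know.assume, hs]; rfl,
      Set.mem_union_right _ ⟨u, Finmap.lookup_singleton_eq, hu⟩⟩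
  have h₁ : k.unsettled x τ = 1 := if_neg (by
    rintro ⟨s', hs', hτ'⟩
    rw [hs] at hs'
    exact hτ (Option.some.inj hs' ▸ hτ'))
  rw [h₀, h₁]
  exact zero_lt_one

theorem Ann.weight_untyp_lt_of_pos {n : ℕ} (hn : 0 < n) (η : Expr S) (k : Know S) :
    Ann.untyp.weight η k < pow (n : Ordinal) := by
  simp only [Ann.weight]
  exact pow_lt_pow (by exact_mod_cast hn)

theorem Res.lowers_subst_typ_untyp {Γ : Env S} {η : Expr S} {k : Know S} {n : ℕ} (hn : 0 < n)
    (Ps : List (Subst S)) : (Res.subst Ps .typ .untyp).Lowers Γ η k (pow (n : Ordinal)) :=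
  ⟨by simp only [Ann.weight]; exact pow_lt_pow (by exact_mod_cast hn),
    Ann.weight_untyp_lt_of_pos hn η k⟩

theorem Env.erase_singleton (x : Var) (t : Ty S) :
    Finmap.erase x (Finmap.singleton x t : Env S) = ∅ := by
  apply Finmap.ext_lookup
  intro z
  by_cases hz : z = x
  · subst hz
    simp
  · rw [Finmap.lookup_erase_ne hz, Finmap.lookup_eq_none.2 (by simpa using hz)]
    rfl

/-- The annotation with which an iteration goes on after a substitution is lighter. -/
theorem weight_inter_subst_lt {Γ : Env S} {η : Expr S} {k : Know S} {A A₁ A₂ : Ann S}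
    {Ps : List (Subst S)} (hPs : ∀ ψ ∈ Ps, Subst.Disj ψ Γ)
    (hd : Derives ⟨.plain, Γ, η, A⟩ (.subst Ps A₁ A₂))
    (h₁ : A₁.weight η k < A.weight η k) (h₂ : A₂.weight η k < A.weight η k) :
    (Ann.inter (Ps.map (fun ψ => A₁.subst ψ) ++ [A₂]) []).weight η k < A.weight η k := by
  refine Ann.weight_inter_lt_of_forall_lt (fun S₁ S₂ hA => ?_) (by simp) fun X hX => ?_
  -- If `A` were an intersection, its plain result could not be iterated, contrary to `hPs`.
  · exact hd.not_iterable (.inr ⟨S₁, S₂, hA⟩) hPs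
  · rcases List.mem_append.1 hX with hX | hX
    · obtain ⟨ψ, -, rfl⟩ := List.mem_map.1 hX
      exact (Ann.weight_subst_le ψ (.refl k) A₁ η).trans_lt h₁
    · obtain rfl := List.mem_singleton.1 hX
      exact h₂

/-- Rules that return the result of their last premise use that this premise has a lighter or equal
annotation (`Lowers.mono`); rules that wrap the result use `Lowers.map`; axioms are read off from
the weights. The induction hypothesis is for all `k`, since a premise in an extended environment
needs its own knowledge. -/
theorem Rule.lowers {c : Call S} {ps : List (Call S × Res S)} {r : Res S} (h : Rule c ps r)
    (hd : ∀ p ∈ ps, Derives p.1 p.2)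
    (ih : ∀ p ∈ ps, ∀ k, p.1.env.Conforms k →
      p.2.Lowers p.1.env p.1.expr k (p.1.ann.weight p.1.expr k))
    (k : Know S) (hk : c.env.Conforms k) :
    r.Lowers c.env c.expr k (c.ann.weight c.expr k) := by
  have fst : ∀ {p : Call S × Res S} {l}, ps = p :: l → ∀ k, p.1.env.Conforms k →
      p.2.Lowers p.1.env p.1.expr k (p.1.ann.weight p.1.expr k) := by
    rintro p l rfl
    exact ih p List.mem_cons_self
  have snd : ∀ {p q : Call S × Res S} {l}, ps = q :: p :: l → ∀ k, p.1.env.Conforms k →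
      p.2.Lowers p.1.env p.1.expr k (p.1.ann.weight p.1.expr k) := by
    rintro p q l rfl
    exact ih p (List.mem_cons_of_mem _ List.mem_cons_self)
  cases h
  case ok | fail | const | axOk | axFail | pairOk | caseEmpty | caseOk₁ | caseOk₂ | lamEmpty | formOk
      | bindTrySkip₂ | bindOk | interEmpty | interOk => trivial
  case pairVar₁ h | appVar₁ h =>
    simp only [Ann.weight, Expr.weight, Atom.weight]
    refine ⟨h, ?_, Ann.weight_untyp_lt_of_pos (by omega) _ _⟩
    simp only [Ann.weight, Expr.weight, Atom.weight]
    refine pow_natCast_lt ?_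
    have := Know.missing_set_lt hk h
    have := (Know.refines_set_of_notMem hk h).missing_le
    grind
  case pairVar₂ h | appVar₂ h =>
    simp only [Ann.weight, Expr.weight, Atom.weight]
    refine ⟨h, ?_, Ann.weight_untyp_lt_of_pos (by omega) _ _⟩
    simp only [Ann.weight, Expr.weight, Atom.weight]
    refine pow_natCast_lt ?_
    have := Know.missing_set_lt hk h
    have := (Know.refines_set_of_notMem hk h).missing_le
    grind
  case projVar h | formVar h =>
    simp only [Ann.weight, Expr.weight, Atom.weight, Form.weight]
    refine ⟨h, ?_, Ann.weight_untyp_lt_of_pos (by omega) _ _⟩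
    simp only [Ann.weight, Expr.weight, Atom.weight, Form.weight]
    exact pow_natCast_lt (by have := Know.missing_set_lt hk h; omega)
  case projInfer | appInfer =>
    simp only [Ann.weight, Expr.weight, Atom.weight]
    exact Res.lowers_subst_typ_untyp (by omega) _
  case caseVar x τ x₁ x₂ h =>
    simp only [Ann.weight, Expr.weight, Atom.weight]
    refine ⟨h, ?_, Ann.weight_untyp_lt_of_pos (by omega) _ _⟩
    simp only [Ann.weight, Expr.weight, Atom.weight]
    refine pow_natCast_lt ?_
    have := Know.missing_set_lt hk h
    have := (Know.refines_set_of_notMem hk h).unsettled_le x τ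
    omega
  case caseSplit Γ x τ x₁ x₂ t hx h₁ h₂ =>
    -- Both outcomes `τ` and `¬ τ` settle the test, which was open by the guards of the rule.
    have key : ∀ u, τ ∈ Know.tests u → Ann.infer.weight (.atom (.tcase x τ x₁ x₂))
        (k.assume (Finmap.singleton (.bnd x) u)) <
          Ann.infer.weight (.atom (.tcase x τ x₁ x₂)) k := by
      intro u hu
      simp only [Ann.weight, Expr.weight, Atom.weight]
      refine pow_natCast_lt ?_
      have := Know.unsettled_assume_lt hk hx h₁ h₂ hu
      have := (k.assume_refines (Finmap.singleton (.bnd x) u)).missing_le x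
      omega
    exact ⟨key _ (.inl rfl), .inr (.inr ⟨x, _, rfl, key _ (.inr rfl)⟩)⟩
  case caseThen | caseElse =>
    simp only [Ann.weight, Expr.weight, Atom.weight]
    refine ⟨?_, ?_⟩ <;> simp only [Ann.weight]
    · exact pow_lt_pow (by exact_mod_cast (by omega))
    · exact pow_lt_pow (by exact_mod_cast (by omega))
  case caseVar₁ h | caseVar₂ h =>
    simp only [Ann.weight]
    refine ⟨h, ?_, ?_⟩ <;> simp only [Ann.weight] <;> exact pow_lt_pow zero_lt_one
  case lamInfer => exact (fst rfl k hk).mono (Ann.weight_lam_infer_lt _).le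
  case lam =>
    refine (fst rfl k (hk.insert_lam _ _)).map_same hk (fun y hy h => hy ?_)
      fun X k' _ hX => Ann.weight_lam_lt hX
    exact Finmap.mem_insert.2 (.inr h)
  case bindInfer => exact (fst rfl k hk).mono Ann.weight_trySkip_infer_lt.le
  case bindTrySkip₁ =>
    have h₁ := fst rfl k hk
    exact (snd rfl k hk).mono (Ann.weight_tryKeep_infer_lt h₁.2.1 h₁.2.2).le
  case bindTrySkip₃ =>
    exact (fst rfl k hk).map_same hk (fun _ h => h) fun X k' _ hX => Ann.weight_trySkip_lt hX
  case bindSkip₁ =>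
    have h₁ := fst rfl k hk
    exact (snd rfl k hk).mono (Ann.weight_skip_lt h₁.2.2).le
  case bindSkip₂ =>
    exact (fst rfl k hk).map_same hk (fun _ h => h) fun X k' _ hX => Ann.weight_skip_lt hX
  case bindTryKeep₁ => exact (snd rfl k hk).mono (Ann.weight_keep_any_lt _ _ _ _).le
  case bindTryKeep₂ => exact (snd rfl k hk).mono (Ann.weight_skip_lt_tryKeep _ _ _).le
  case bindTryKeep₃ =>
    exact (fst rfl k hk).map_same hk (fun _ h => h)
      fun X k' hk' hX => Ann.weight_tryKeep_lt hk' hX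
  case bindKeep₁ h _ _ => exact (snd rfl k hk).mono (Ann.weight_keep_removeSplit_lt _ _ h _ _).le
  case bindKeep₂ Γ x a κ A S₁ S₂ t B aa s G B₁ B₂ u Gs₁ Gs₂ h _ _ hG _ _ =>
    obtain ⟨h₁, h₂⟩ := fst rfl _ (hk.insert_bnd x s t)
    -- Refining the split `t` to `t ∧ v` records at least what the assumption of `v` on `x` gives.
    have hset : ∀ G' : Env S, ∀ v, G'.lookup (.bnd x) = some v →
        ((k.assume (G'.erase (.bnd x))).set x (t.and v).settled).Refines
          ((k.set x t.settled).assume G') := by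
      intro G' v hv
      rw [Know.assume_set]
      refine (Know.Refines.refl _).set x (subset_trans ?_ (t.settled_and v))
      refine Set.union_subset_union_right _ ?_
      rintro τ ⟨v', hv', hτ⟩
      rw [hv] at hv'
      exact Option.some.inj hv' ▸ hτ
    have hdiff : t.settled ⊆ (t.diff u).settled := fun τ hτ => .left _ hτ
    have hG' : G ≠ ∅ := by
      rintro rfl
      simp at hG
    refine ⟨Ann.weight_prop_lt_keep h S₂ (k.assume_refines _)
      ((Ann.weight_le (hset G u hG) B₁ _).trans_lt h₁) ?_, ?_⟩
    · rcases h₂ with h₂ | h₂ | ⟨y, v, rfl, h₂⟩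
      · exact absurd h₂ hG'
      · exact (Ann.weight_le ((k.assume_refines _).set x hdiff) B₂ _).trans_lt h₂
      · obtain rfl : x = y := by
          have := Finmap.mem_of_lookup_eq_some hG
          simpa using this
        obtain rfl : v = u := by simpa using hG
        -- `t.diff v` is by definition the intersection of `t` with `v.neg`, so `hset` applies to
        -- the negated assumption.
        refine (Ann.weight_le ?_ B₂ _).trans_lt h₂
        have := hset (Finmap.singleton (.bnd x) v.neg) v.neg Finmap.lookup_singleton_eq
        rw [Env.erase_singleton] at this ⊢
        exact this
    · rcases h₂ with h₂ | h₂ | ⟨y, v, rfl, h₂⟩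
      · exact absurd h₂ hG'
      · exact .inr (.inl (Ann.weight_keep_lt h S₂ (.refl k) h₂))
      -- The assumption was on `x` alone, so nothing is left after erasing it: the second annotation
      -- will not be used and needs no bound.
      · obtain rfl : x = y := by
          have := Finmap.mem_of_lookup_eq_some hG
          simpa using this
        exact .inl (Env.erase_singleton _ _)
  case bindKeep₃ Γ x a κ A S₁ S₂ t B aa s r h _ _ _ hG =>
    refine (fst rfl _ (hk.insert_bnd x s t)).map (fun k => k.set x t.settled) hk
      (fun y hy hy' => hy (Finmap.mem_insert.2 (.inr hy'))) ?_ ?_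
      fun X k' hk' hX => Ann.weight_keep_lt h S₂ hk' hX
    · intro G A₁ A₂ hr G' hG'
      -- Assumptions on `x` itself are excluded by the guard of this rule; they are the business of
      -- `bindKeep₂`.
      exact Know.assume_set_of_notMem _ (fun hx => hG G A₁ A₂ hr (hG' _ hx)) _
    · intro y hy
      refine Know.set_comm _ ?_ _ _
      rintro rfl
      exact hy (Finmap.mem_insert.2 (.inl rfl))
  case bindProp₁ h _ =>
    refine ⟨(Ann.weight_le (k.assume_refines _) _ _).trans_lt (Ann.weight_keep_lt_prop _ _ _ _ _ _),
      .inr (.inl (Ann.weight_prop_removeEnv_lt _ h _ _))⟩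
  case bindProp₂ => exact (fst rfl k hk).mono (Ann.weight_keep_lt_prop _ _ _ _ _ _).le
  case inter₁ h | inter₂ h => exact (snd rfl k hk).mono (Ann.weight_inter_remove_lt h _ _).le
  case inter₃ h _ _ =>
    exact (fst rfl k hk).map_same hk (fun _ h => h) fun X k' hk' hX => Ann.weight_inter_lt h _ hk' hX
  case iterate₁ =>
    have h₁ := (fst rfl k hk).1
    rw [Know.assume_empty] at h₁
    exact (snd rfl k hk).mono h₁.le
  case iterate₂ h =>
    have h₁ := fst rfl k hk
    exact (snd rfl k hk).mono (weight_inter_subst_lt h (hd _ List.mem_cons_self) h₁.1 h₁.2).le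
  case iterStop => exact fst rfl k hk

theorem Derives.lowers {c : Call S} {r : Res S} (h : Derives c r) :
    ∀ k, c.env.Conforms k → r.Lowers c.env c.expr k (c.ann.weight c.expr k) := by
  induction h with
  | mk h hd ih => exact h.lowers hd ih

/-! ### Termination -/

theorem eq_of_singleton_eq_append {X : Type} {p q : X} {pre post : List X}
    (h : [p] = pre ++ q :: post) : q = p := by
  cases pre with
  | nil => exact (List.cons.inj h).1.symm
  | cons => simp at h

theorem eq_or_eq_of_pair_eq_append {X : Type} {p₁ p₂ q : X} {pre post : List X}
    (h : [p₁, p₂] = pre ++ q :: post) : q = p₁ ∨ (p₁ ∈ pre ∧ q = p₂) := by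
  cases pre with
  | nil => exact .inl (List.cons.inj h).1.symm
  | cons p pre =>
    obtain ⟨rfl, h'⟩ := List.cons.inj h
    exact .inr ⟨by simp, eq_of_singleton_eq_append h'⟩

/-- A judgment evaluated as a premise is on a smaller expression, or has a lighter annotation, or is
the plain version of an iterated judgment. -/
theorem Rule.descends {c c' : Call S} {ps pre post : List (Call S × Res S)} {r r' : Res S}
    (h : Rule c ps r) (hps : ps = pre ++ (c', r') :: post) (hd : ∀ p ∈ pre, Derives p.1 p.2)
    {k : Know S} (hk : c.env.Conforms k) :
    sizeOf c'.expr < sizeOf c.expr ∨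
      (c'.env = c.env ∧ c'.expr = c.expr ∧ c'.ann.weight c'.expr k < c.ann.weight c.expr k) ∨
      (c.mode = .iter ∧ c' = ⟨.plain, c.env, c.expr, c.ann⟩) := by
  cases h
  case lamInfer =>
    obtain ⟨rfl, rfl⟩ := Prod.mk.inj (eq_of_singleton_eq_append hps)
    exact .inr (.inl ⟨rfl, rfl, Ann.weight_lam_infer_lt _⟩)
  case bindInfer =>
    obtain ⟨rfl, rfl⟩ := Prod.mk.inj (eq_of_singleton_eq_append hps)
    exact .inr (.inl ⟨rfl, rfl, Ann.weight_trySkip_infer_lt⟩)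
  case bindProp₂ =>
    obtain ⟨rfl, rfl⟩ := Prod.mk.inj (eq_of_singleton_eq_append hps)
    exact .inr (.inl ⟨rfl, rfl, Ann.weight_keep_lt_prop _ _ _ _ _ _⟩)
  case inter₃ h _ _ =>
    obtain ⟨rfl, rfl⟩ := Prod.mk.inj (eq_of_singleton_eq_append hps)
    exact .inr (.inl ⟨rfl, rfl, Ann.weight_lt_inter h _⟩)
  case iterStop =>
    obtain ⟨rfl, rfl⟩ := Prod.mk.inj (eq_of_singleton_eq_append hps)
    exact .inr (.inr ⟨rfl, rfl⟩)
  case lam | bindTrySkip₂ | bindTrySkip₃ | bindSkip₂ | bindTryKeep₃ | bindKeep₂ | bindKeep₃ =>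
    obtain ⟨rfl, rfl⟩ := Prod.mk.inj (eq_of_singleton_eq_append hps)
    exact .inl (by simp <;> omega)
  case bindTrySkip₁ =>
    rcases eq_or_eq_of_pair_eq_append hps with h | ⟨hpre, h⟩ <;>
      obtain ⟨rfl, rfl⟩ := Prod.mk.inj h
    · exact .inl (by simp)
    -- The annotation of the second premise stems from the result of the first, which is derivable
    -- and hence lowers the weight.
    · have h₁ := (hd _ hpre).lowers k hk
      exact .inr (.inl ⟨rfl, rfl, Ann.weight_tryKeep_infer_lt h₁.2.1 h₁.2.2⟩)
  case bindSkip₁ =>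
    rcases eq_or_eq_of_pair_eq_append hps with h | ⟨hpre, h⟩ <;>
      obtain ⟨rfl, rfl⟩ := Prod.mk.inj h
    · exact .inl (by simp)
    · have h₁ := (hd _ hpre).lowers k hk
      exact .inr (.inl ⟨rfl, rfl, Ann.weight_skip_lt h₁.2.2⟩)
  case bindTryKeep₁ =>
    rcases eq_or_eq_of_pair_eq_append hps with h | ⟨hpre, h⟩ <;>
      obtain ⟨rfl, rfl⟩ := Prod.mk.inj h
    · exact .inl (by simp; omega)
    · exact .inr (.inl ⟨rfl, rfl, Ann.weight_keep_any_lt _ _ _ _⟩)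
  case bindTryKeep₂ =>
    rcases eq_or_eq_of_pair_eq_append hps with h | ⟨hpre, h⟩ <;>
      obtain ⟨rfl, rfl⟩ := Prod.mk.inj h
    · exact .inl (by simp; omega)
    · exact .inr (.inl ⟨rfl, rfl, Ann.weight_skip_lt_tryKeep _ _ _⟩)
  case bindKeep₁ hm _ _ =>
    rcases eq_or_eq_of_pair_eq_append hps with h | ⟨hpre, h⟩ <;>
      obtain ⟨rfl, rfl⟩ := Prod.mk.inj h
    · exact .inl (by simp)
    · exact .inr (.inl ⟨rfl, rfl, Ann.weight_keep_removeSplit_lt _ _ hm _ _⟩)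
  case inter₁ hm | inter₂ hm =>
    rcases eq_or_eq_of_pair_eq_append hps with h | ⟨hpre, h⟩ <;>
      obtain ⟨rfl, rfl⟩ := Prod.mk.inj h
    · exact .inr (.inl ⟨rfl, rfl, Ann.weight_lt_inter hm _⟩)
    · exact .inr (.inl ⟨rfl, rfl, Ann.weight_inter_remove_lt hm _ _⟩)
  case iterate₁ =>
    rcases eq_or_eq_of_pair_eq_append hps with h | ⟨hpre, h⟩ <;>
      obtain ⟨rfl, rfl⟩ := Prod.mk.inj h
    · exact .inr (.inr ⟨rfl, rfl⟩)
    · have h₁ := ((hd _ hpre).lowers k hk).1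
      rw [Know.assume_empty] at h₁
      exact .inr (.inl ⟨rfl, rfl, h₁⟩)
  case iterate₂ hPs =>
    rcases eq_or_eq_of_pair_eq_append hps with h | ⟨hpre, h⟩ <;>
      obtain ⟨rfl, rfl⟩ := Prod.mk.inj h
    · exact .inr (.inr ⟨rfl, rfl⟩)
    · have h₁ := (hd _ hpre).lowers k hk
      exact .inr (.inl ⟨rfl, rfl, weight_inter_subst_lt hPs (hd _ hpre) h₁.1 h₁.2⟩)
  all_goals simp at hps

/-- Weights are compared only within one expression and one environment, for a fixed `k`. When the
expression gets smaller, a new knowledge is chosen and the weight is unconstrained. -/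
theorem acc_calls_of_weight : ∀ (n : ℕ) (w : Weight) (c : Call S) (k : Know S), c.env.Conforms k →
    sizeOf c.expr = n → c.ann.weight c.expr k = w → Acc Calls c := by
  intro n
  induction n using Nat.strong_induction_on with
  | _ n ihn =>
    intro w
    induction w using wf_lt.induction with
    | _ w ihw =>
      -- Plain judgments come first: an iterated judgment calls its plain version with the same
      -- weight.
      have plain : ∀ (c : Call S) (k : Know S), c.env.Conforms k → sizeOf c.expr = n →
          c.ann.weight c.expr k = w → c.mode = .plain → Acc Calls c := by
        rintro c k hk rfl rfl hm
        refine .intro _ ?_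
        rintro c' ⟨ps, r', qs, r, h, hd⟩
        rcases h.descends rfl hd hk with h | ⟨henv, hexpr, h⟩ | ⟨h, -⟩
        · obtain ⟨k', hk'⟩ := c'.env.exists_conforms
          exact ihn _ h _ c' k' hk' rfl rfl
        · exact ihw _ h c' k (henv ▸ hk) (by rw [hexpr]) rfl
        · rw [hm] at h
          cases h
      rintro c k hk rfl rfl
      refine .intro _ ?_
      rintro c' ⟨ps, r', qs, r, h, hd⟩
      rcases h.descends rfl hd hk with h | ⟨henv, hexpr, h⟩ | ⟨-, rfl⟩
      · obtain ⟨k', hk'⟩ := c'.env.exists_conforms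
        exact ihn _ h _ c' k' hk' rfl rfl
      · exact ihw _ h c' k (henv ▸ hk) (by rw [hexpr]) rfl
      · exact plain _ k hk rfl rfl rfl

theorem acc_calls (c : Call S) : Acc Calls c := by
  obtain ⟨k, hk⟩ := c.env.exists_conforms
  exact acc_calls_of_weight _ _ c k hk rfl rfl

end Recon

theorem mainTheorem5 (S : Recon.Sig) (c : Recon.Call S) :
    (¬ ∃ f : ℕ → Recon.State S, f 0 = Recon.State.init c ∧ ∀ n, Recon.Step (f n) (f (n + 1))) ∧
    (∀ s, Relation.ReflTransGen Recon.Step (Recon.State.init c) s → (∀ s', ¬ Recon.Step s s') →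
      s.Failed ∨ ∃ r, s = .final r) ∧
    ∀ r, Relation.ReflTransGen Recon.Step (Recon.State.init c) (.final r) ↔
      Recon.Derives c r :=
  ⟨Recon.not_infinite_run (Recon.acc_calls c), fun _ _ h => Recon.failed_or_final h,
    fun _ => ⟨Recon.derives_of_run, Recon.run_of_derives⟩⟩
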